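/- Let $n\ge 0$ and let $\mathbf k=(k_1,\dots,k_n)$ be a weak composition of $n$ (nonnegative integers with sum $n$). *Tournaments.* Consider trivalent trees $T$ (finite trees in which every vertex has degree $1$ or $3$, up to label-preserving isomorphism) whose leaves are labeled bijectively by $a<b<c<1<2<\dots<n$. The lazy tournament of $T$ labels the edges of $T$: first each leaf edge gets the label of its leaf; then, until all edges are labeled, one repeats the following round. Among all pairs of labeled edges, with labels $i<j$, that share a vertex whose third edge $E$ is unlabeled, take the pair with the largest $i$; $j$ wins the round and $i$ loses it; $E$ is labeled by $i$ if $E$ is adjacent to an edge with a label $u\ne j$, $u>i$, and by $j$ otherwise. Let $\mathrm{Tour}(\mathbf k)$ be the set of those $T$ in which the leaf edges $a$ and $b$ share a vertex and each label $j\in\{1,\dots,n\}$ wins exactly $k_j$ rounds. *Parking functions.* A parking function of size $n$ is a lattice path from $(0,n)$ to $(n,0)$ with unit steps right and down that stays weakly above the line $x+y=n$, together with a labeling of the squares just to the left of its down steps by the cars $1,\dots,n$, each used once, that increases up each column; columns are numbered $1,\dots,n$ from left to right. For a car $x$ let $d_x$ be the number of columns strictly to the right of $x$ that contain no car greater than $x$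 (empty columns included). Let $\mathrm{CPF}(\mathbf k)$ be the set of parking functions of size $n$ with $d_x<x$ for all cars $x$ and with exactly $k_j$ cars in column $j$ for all $j$. *The maps.* Let $\tau(T)$ be the filling that has car $m$ in column $j$ if and only if label $j$ wins round $m$ of the tournament of $T$. Now let $n\ge1$, let $i$ be the largest index with $k_i=0$ ($i=c$ if there is none), and for $j>i$ let $\widetilde{\mathbf k}_j$ be the weak composition of $n-1$ obtained from $\mathbf k$ by decreasing $k_j$ by $1$ and then deleting the rightmost $0$. For $T\in\mathrm{Tour}(\mathbf k)$ let $i'<j$ be the first pair to face off and $v$ the vertex adjacent to the leaves $i'$ and $j$. If $k_j>1$, $\pi_{\mathrm{lazy}}(T)$ is obtained by labeling $v$ by $j$, removing the leaves $i'$ and $j$ and their edges, and decreasing all labels above $i'$ by $1$; if $k_j=1$, by labeling $v$ by $i'$, removing the leaves $i'$ and $j$ and their edges, and decreasing all labels above $j$ by $1$. It is placed in the summand indexed by $j$. For a parking function $P$, $r(P)$ is obtained by removing car $1$ with its row, decrementing the other cars, and deleting the rightmost empty column; $\hat r(P)$ is $r(P)$ placed in the summand indexed by the column of car $1$ in $P$.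 **Proposition.** For every weak composition $\mathbf k$ of $n$, $\tau$ is a well-defined bijection from $\mathrm{Tour}(\mathbf k)$ to $\mathrm{CPF}(\mathbf k)$. If $n\ge1$, then $\pi_{\mathrm{lazy}}:\mathrm{Tour}(\mathbf k)\to\coprod_{j>i}\mathrm{Tour}(\widetilde{\mathbf k}_j)$ and $\hat r:\mathrm{CPF}(\mathbf k)\to\coprod_{j>i}\mathrm{CPF}(\widetilde{\mathbf k}_j)$ are well-defined, and $\hat r\circ\tau=\bigl(\coprod_{j>i}\tau\bigr)\circ\pi_{\mathrm{lazy}}$. -/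

import Mathlib

/-- The ordered label set `a < b < c < 1 < 2 < ⋯ < n` is modelled by `Fin (n + 3)`:
`a, b, c` are `0, 1, 2`, and the number `j + 1` (for `j : Fin n`) is `num j`. -/
abbrev Label (n : ℕ) : Type := Fin (n + 3)

/-- The numeric label `j + 1`, for `j : Fin n`. -/
def num {n : ℕ} (j : Fin n) : Label n := j.addNat 3

/-- A trivalent tree with leaves labelled by `a, b, c, 1, …, n`: a finite tree all of whose
vertices have degree `1` or `3`, with a bijection from the labels to the vertices of degree `1`.
(As there are at least three leaves, some vertex has degree `3`.) -/
structure TrivalentTree (n : ℕ) where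
  V : Type
  finite : Finite V
  G : SimpleGraph V
  isTree : G.IsTree
  degree : ∀ v, (G.neighborSet v).ncard = 1 ∨ (G.neighborSet v).ncard = 3
  leaf : Label n → V
  leaf_injective : Function.Injective leaf
  leaf_range : ∀ v, (∃ x, leaf x = v) ↔ (G.neighborSet v).ncard = 1

namespace TrivalentTree

variable {n : ℕ}

/-- The leaf edges `a` and `b` share a vertex. -/
def ABShareVertex (T : TrivalentTree n) : Prop :=
  ∃ v, T.G.Adj v (T.leaf 0) ∧ T.G.Adj v (T.leaf 1)

/-- A partial labelling of the edges; `none` means unlabelled. -/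
abbrev EdgeLabeling (T : TrivalentTree n) : Type := Sym2 T.V → Option (Label n)

/-- The labelling at the start of the tournament: exactly the leaf edges are labelled, each by
the label of its leaf. -/
def IsInitial (T : TrivalentTree n) (lab : T.EdgeLabeling) : Prop :=
  ∀ e x, lab e = some x ↔ e ∈ T.G.edgeSet ∧ T.leaf x ∈ e

/-- Two edges labelled `i < j` share a vertex whose third edge `E` is unlabelled. -/
def CanFaceOff (T : TrivalentTree n) (lab : T.EdgeLabeling) (i j : Label n) (E : Sym2 T.V) :
    Prop :=
  i < j ∧ ∃ v, ∃ e ∈ T.G.incidenceSet v, ∃ f ∈ T.G.incidenceSet v,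
    e ≠ f ∧ E ∈ T.G.incidenceSet v ∧ lab e = some i ∧ lab f = some j ∧ lab E = none

/-- The pair `(i, j)` faces off at the edge `E`: among all available pairs, it has the largest
smaller label `i`. -/
def FacesOff (T : TrivalentTree n) (lab : T.EdgeLabeling) (i j : Label n) (E : Sym2 T.V) :
    Prop :=
  T.CanFaceOff lab i j E ∧ ∀ i' j' E', T.CanFaceOff lab i' j' E' → i' ≤ i

/-- The laziness rule applies: `E` is adjacent to an edge with a label `u ≠ j`, `u > i`. -/
def LazinessApplies (T : TrivalentTree n) (lab : T.EdgeLabeling) (i j : Label n)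
    (E : Sym2 T.V) : Prop :=
  ∃ g ∈ T.G.edgeSet, g ≠ E ∧ (∃ w, w ∈ E ∧ w ∈ g) ∧ ∃ u, lab g = some u ∧ u ≠ j ∧ i < u

open Classical in
/-- The labelling after `(i, j)` have faced off at `E`: the loser `i` advances to `E` if the
laziness rule applies, and otherwise the winner `j` advances. -/
noncomputable def advance (T : TrivalentTree n) (lab : T.EdgeLabeling) (i j : Label n)
    (E : Sym2 T.V) : T.EdgeLabeling :=
  fun e => if e = E then some (if T.LazinessApplies lab i j E then i else j) else lab e

/-- `Run lab rs`: starting from `lab`, the process runs until all edges are labelled, and `rs` is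
the list of its rounds in order, each recorded as the pair (loser, winner). -/
inductive Run (T : TrivalentTree n) : T.EdgeLabeling → List (Label n × Label n) → Prop
  | done (lab : T.EdgeLabeling) : (∀ e ∈ T.G.edgeSet, lab e ≠ none) → Run T lab []
  | round (lab : T.EdgeLabeling) (i j : Label n) (E : Sym2 T.V)
      (rs : List (Label n × Label n)) :
      T.FacesOff lab i j E → Run T (T.advance lab i j E) rs → Run T lab ((i, j) :: rs)

/-- `rs` is the list of rounds (loser, winner) of the lazy tournament of `T`. -/
def IsTournament (T : TrivalentTree n) (rs : List (Label n × Label n)) : Prop :=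
  ∃ lab, T.IsInitial lab ∧ T.Run lab rs

/-- The pair `i < j` is the first to face off, and `v` is the vertex adjacent to the leaves `i`
and `j`. -/
def FirstFaceOff (T : TrivalentTree n) (i j : Label n) (v : T.V) : Prop :=
  (∃ lab, T.IsInitial lab ∧ ∃ E, T.FacesOff lab i j E) ∧
    T.G.Adj v (T.leaf i) ∧ T.G.Adj v (T.leaf j)

open Classical in
/-- `T'` is the tree formed from `T` by giving the vertex `v` the label `keep`, removing the
leaves `keep` and `drop` together with their edges, and decreasing all labels above `drop` by one.
The map `φ` is the inclusion of what is left; the label `y` of `T'` was `drop.succAbove y`, that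
is, `y` or `y + 1`, before the decrease. -/
def IsPruning (T : TrivalentTree (n + 1)) (v : T.V) (keep drop : Label (n + 1))
    (T' : TrivalentTree n) : Prop :=
  ∃ φ : T'.G ↪g T.G, Set.range φ = {w | w ≠ T.leaf keep ∧ w ≠ T.leaf drop} ∧
    ∀ y : Label n, φ (T'.leaf y) =
      if drop.succAbove y = keep then v else T.leaf (drop.succAbove y)

/-- `T'` is formed from `T` as in the definition of the map `π_lazy` for `k`, where `j` is the
winner of the first round: the vertex `v` next to the leaves `i` and `j` of the first pair gets
label `j` if `k_j > 1` and label `i` otherwise. -/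
def IsPiLazy (k : Fin (n + 1) → ℕ) (T : TrivalentTree (n + 1)) (j : Fin (n + 1))
    (T' : TrivalentTree n) : Prop :=
  ∃ i v, T.FirstFaceOff i (num j) v ∧
    if 1 < k j then T.IsPruning v (num j) i T' else T.IsPruning v i (num j) T'

/-- Isomorphism of leaf-labelled trees. -/
instance setoid (n : ℕ) : Setoid (TrivalentTree n) where
  r T T' := ∃ φ : T.G ≃g T'.G, ∀ x, φ (T.leaf x) = T'.leaf x
  iseqv :=
    { refl := fun T => ⟨RelIso.refl _, fun _ => rfl⟩
      symm := fun ⟨φ, h⟩ => ⟨φ.symm, fun x => by rw [← h x]; exact φ.symm_apply_apply _⟩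
      trans := fun ⟨φ, h⟩ ⟨ψ, h'⟩ => ⟨φ.trans ψ, fun x => by rw [← h' x, ← h x]; rfl⟩ }

/-! The tournament does not change under isomorphism. -/

section Invariance

variable {T T' : TrivalentTree n} {lab : T.EdgeLabeling} {lab' : T'.EdgeLabeling}
  {i j : Label n} {E : Sym2 T.V}

theorem map_mem_edgeSet (φ : T.G ≃g T'.G) {e : Sym2 T.V} (h : e ∈ T.G.edgeSet) :
    e.map φ ∈ T'.G.edgeSet := by
  induction e with
  | _ x y => exact φ.map_adj_iff.2 h

theorem map_mem_incidenceSet (φ : T.G ≃g T'.G) {e : Sym2 T.V} {v : T.V}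
    (h : e ∈ T.G.incidenceSet v) : e.map φ ∈ T'.G.incidenceSet (φ v) :=
  ⟨map_mem_edgeSet φ h.1, Sym2.mem_map.2 ⟨v, h.2, rfl⟩⟩

theorem symm_map_map (φ : T.G ≃g T'.G) (e : Sym2 T.V) : (e.map φ).map φ.symm = e := by
  induction e with
  | _ x y => simp

theorem map_symm_map (φ : T.G ≃g T'.G) (e : Sym2 T'.V) : (e.map φ.symm).map φ = e :=
  symm_map_map φ.symm e

theorem CanFaceOff.map (φ : T.G ≃g T'.G) (hlab : ∀ e, lab' (e.map φ) = lab e)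
    (h : T.CanFaceOff lab i j E) : T'.CanFaceOff lab' i j (E.map φ) := by
  obtain ⟨hij, v, e, he, f, hf, hef, hE, h1, h2, h3⟩ := h
  refine ⟨hij, φ v, e.map φ, map_mem_incidenceSet φ he, f.map φ, map_mem_incidenceSet φ hf, ?_,
    map_mem_incidenceSet φ hE, ?_, ?_, ?_⟩
  · exact fun h => hef (Sym2.map.injective φ.injective h)
  all_goals rw [hlab]; assumption

theorem LazinessApplies.map (φ : T.G ≃g T'.G) (hlab : ∀ e, lab' (e.map φ) = lab e)
    (h : T.LazinessApplies lab i j E) : T'.LazinessApplies lab' i j (E.map φ) := by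
  obtain ⟨g, hg, hgE, ⟨w, hw, hw'⟩, u, hu, h1, h2⟩ := h
  refine ⟨g.map φ, map_mem_edgeSet φ hg, fun h => hgE (Sym2.map.injective φ.injective h),
    ⟨φ w, Sym2.mem_map.2 ⟨w, hw, rfl⟩, Sym2.mem_map.2 ⟨w, hw', rfl⟩⟩, u, ?_, h1, h2⟩
  rw [hlab]; exact hu

theorem symm_lab (φ : T.G ≃g T'.G) (hlab : ∀ e, lab' (e.map φ) = lab e) (e : Sym2 T'.V) :
    lab (e.map φ.symm) = lab' e := by
  rw [← hlab, map_symm_map]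

theorem FacesOff.map (φ : T.G ≃g T'.G) (hlab : ∀ e, lab' (e.map φ) = lab e)
    (h : T.FacesOff lab i j E) : T'.FacesOff lab' i j (E.map φ) :=
  ⟨h.1.map φ hlab, fun i' j' _ h' => h.2 i' j' _ (h'.map φ.symm (symm_lab φ hlab))⟩

theorem advance_map (φ : T.G ≃g T'.G) (hlab : ∀ e, lab' (e.map φ) = lab e) (e : Sym2 T.V) :
    T'.advance lab' i j (E.map φ) (e.map φ) = T.advance lab i j E e := by
  have h1 : e.map φ = E.map φ ↔ e = E := (Sym2.map.injective φ.injective).eq_iff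
  have h2 : T'.LazinessApplies lab' i j (E.map φ) ↔ T.LazinessApplies lab i j E :=
    ⟨fun h => by simpa only [symm_map_map] using h.map φ.symm (symm_lab φ hlab),
      fun h => h.map φ hlab⟩
  unfold advance
  rw [hlab]
  by_cases he : e = E <;> by_cases hl : T.LazinessApplies lab i j E <;>
    simp only [if_pos, if_neg, he, hl, mt h1.1, h2.2, mt h2.1, not_false_eq_true]

theorem Run.map (φ : T.G ≃g T'.G) {rs : List (Label n × Label n)} (h : T.Run lab rs) :
    ∀ lab' : T'.EdgeLabeling, (∀ e, lab' (e.map φ) = lab e) → T'.Run lab' rs := by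
  induction h with
  | done lab h =>
    intro lab' hlab
    refine Run.done _ fun e he => ?_
    rw [← symm_lab φ hlab]
    exact h _ (map_mem_edgeSet φ.symm he)
  | round lab i j E rs h _ ih =>
    intro lab' hlab
    exact Run.round _ i j (E.map φ) rs (h.map φ hlab) (ih _ (advance_map φ hlab))

theorem IsInitial.map (φ : T.G ≃g T'.G) (hφ : ∀ x, φ (T.leaf x) = T'.leaf x)
    (h : T.IsInitial lab) : T'.IsInitial fun e => lab (e.map φ.symm) := by
  intro e x
  rw [h, ← hφ]
  refine and_congr ⟨fun h => ?_, map_mem_edgeSet φ.symm⟩ ⟨fun h => ?_, fun h => ?_⟩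
  · simpa only [map_symm_map] using map_mem_edgeSet φ h
  · rw [← map_symm_map φ e]; exact Sym2.mem_map.2 ⟨_, h, rfl⟩
  · exact Sym2.mem_map.2 ⟨_, h, φ.symm_apply_apply _⟩

theorem IsTournament.of_equiv {rs : List (Label n × Label n)} (hT : T ≈ T')
    (h : T.IsTournament rs) : T'.IsTournament rs := by
  obtain ⟨φ, hφ⟩ := hT
  obtain ⟨lab, h0, h⟩ := h
  exact ⟨_, h0.map φ hφ, h.map φ _ fun e => by rw [symm_map_map]⟩

theorem ABShareVertex.of_equiv (hT : T ≈ T') (h : T.ABShareVertex) : T'.ABShareVertex := by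
  obtain ⟨φ, hφ⟩ := hT
  obtain ⟨v, h1, h2⟩ := h
  exact ⟨φ v, by rw [← hφ]; exact φ.map_adj_iff.2 h1, by rw [← hφ]; exact φ.map_adj_iff.2 h2⟩

end Invariance

end TrivalentTree

/-- Leaf-labelled trivalent trees up to isomorphism. -/
def TreeClass (n : ℕ) : Type 1 := Quotient (TrivalentTree.setoid n)

namespace TreeClass

variable {n : ℕ}

/-- The leaf edges `a` and `b` share a vertex. -/
def ABShareVertex (T : TreeClass n) : Prop :=
  Quotient.lift TrivalentTree.ABShareVertex
    (fun _ _ h => propext ⟨fun h' => h'.of_equiv h, fun h' => h'.of_equiv (Setoid.symm h)⟩) T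

/-- `rs` is the list of rounds (loser, winner) of the lazy tournament of `T`. -/
def IsTournament (T : TreeClass n) (rs : List (Label n × Label n)) : Prop :=
  Quotient.lift (fun A : TrivalentTree n => A.IsTournament rs)
    (fun _ _ h => propext ⟨fun h' => h'.of_equiv h, fun h' => h'.of_equiv (Setoid.symm h)⟩) T

/-- Label `j + 1` wins round `m + 1` of the tournament of `T`. -/
def WinsRound (T : TreeClass n) (j : Fin n) (m : ℕ) : Prop :=
  ∃ rs, T.IsTournament rs ∧ ∃ i, rs[m]? = some (i, num j)

/-- `(j, T')` is the value of `π_lazy` at `T ∈ Tour k`: `T'` is formed from `T` as described in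
`TrivalentTree.IsPiLazy`, and lies in the summand indexed by the winner `j` of the first round. -/
def IsPiLazy (k : Fin (n + 1) → ℕ) (T : TreeClass (n + 1)) (j : Fin (n + 1)) (T' : TreeClass n) : Prop :=
  ∃ (A : TrivalentTree (n + 1)) (B : TrivalentTree n),
    (Quotient.mk _ A : TreeClass (n + 1)) = T ∧ (Quotient.mk _ B : TreeClass n) = T' ∧ A.IsPiLazy k j B

end TreeClass

/-- `Tour(k)`: the trees in which the leaf edges `a`, `b` share a vertex and each numeric label
`j` wins exactly `k_j` rounds of the tournament. -/
def Tour {n : ℕ} (k : Fin n → ℕ) : Set (TreeClass n) :=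
  {T | T.ABShareVertex ∧
    ∃ rs, T.IsTournament rs ∧ ∀ j, rs.countP (fun p => p.2 = num j) = k j}

/-- The greatest index with property `p` (only used when there is one). -/
noncomputable def rightmost {n : ℕ} (p : Fin (n + 1) → Prop) [DecidablePred p] : Fin (n + 1) :=
  (Finset.univ.filter p).sup id

/-- `j > i`, where `i` is the largest index with `k_i = 0`, or `i = c` if there is none. -/
def AboveZeros {n : ℕ} (k : Fin n → ℕ) (j : Fin n) : Prop := ∀ l, k l = 0 → l < j

/-- The composition `k̃_j`: decrease `k_j` by one, then remove the rightmost zero. -/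
noncomputable def tilde {n : ℕ} (k : Fin (n + 1) → ℕ) (j : Fin (n + 1)) : Fin n → ℕ :=
  let k' := Function.update k j (k j - 1)
  fun x => k' ((rightmost fun c => k' c = 0).succAbove x)

/-- A filling of the `n` columns of the `n × n` box with the labels (cars) `1, …, n`, one in each
row: `P m` is the column of car `m + 1`, columns being numbered `0, …, n - 1` from left to right. As
the cars in a column increase upwards, the columns of the cars determine the whole picture. -/
abbrev Filling (n : ℕ) : Type := Fin n → Fin n

namespace Filling

variable {n : ℕ}

/-- The number of cars in a column, which is the number of down steps on its right side. -/
def height (P : Filling n) (c : Fin n) : ℕ := (Finset.univ.filter fun m => P m = c).card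

/-- `P` is a parking function: the lattice path from `(0, n)` that makes, for each column from left
to right, one right step and then as many down steps as the column has cars, stays weakly above
the line `x + y = n`. After column `c` the path is at the point
`(c + 1, n - ∑ c' ≤ c, height c')`. -/
def IsParking (P : Filling n) : Prop :=
  ∀ c : Fin n, ∑ c' ∈ Finset.Iic c, P.height c' ≤ c.val + 1

/-- Car `x` dominates the column `c`: it lies to the right of `x` and has no car greater than
`x`. -/
def Dominates (P : Filling n) (x c : Fin n) : Prop := P x < c ∧ ∀ y, P y = c → ¬ x < y

open Classical in
/-- The dominance index of the car `x + 1`. -/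
noncomputable def dominanceIndex (P : Filling n) (x : Fin n) : ℕ :=
  (Finset.univ.filter fun c => P.Dominates x c).card

def IsColumnRestricted (P : Filling n) : Prop := ∀ x : Fin n, P.dominanceIndex x < x.val + 1

/-- The rightmost column that is empty once car `1` has been removed. -/
noncomputable def rightmostEmpty (P : Filling (n + 1)) : Fin (n + 1) :=
  rightmost fun c => ∀ m : Fin n, P m.succ ≠ c

theorem ne_rightmostEmpty (P : Filling (n + 1)) (m : Fin n) : P m.succ ≠ P.rightmostEmpty := by
  have hne : (Finset.univ.filter fun c => ∀ m : Fin n, P m.succ ≠ c).Nonempty := by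
    by_contra h
    rw [Finset.not_nonempty_iff_eq_empty, Finset.filter_eq_empty_iff] at h
    have hs : Function.Surjective fun m : Fin n => P m.succ := fun c => by
      simpa using h (Finset.mem_univ c)
    simpa using Fintype.card_le_of_surjective _ hs
  obtain ⟨c, hc, h⟩ := Finset.exists_mem_eq_sup _ hne id
  have : P.rightmostEmpty = c := h
  rw [this]
  exact (Finset.mem_filter.1 hc).2 m

/-- The map `r`: remove car `1` and decrement the other cars, then delete the rightmost empty
column, so that the columns to its right move one step to the left. -/
noncomputable def r (P : Filling (n + 1)) : Filling n :=
  fun m => (finSuccAboveEquiv P.rightmostEmpty).symm ⟨P m.succ, P.ne_rightmostEmpty m⟩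

end Filling

/-- `CPF(k)`: the column-restricted parking functions with `k_c` cars in each column `c`. -/
def CPF {n : ℕ} (k : Fin n → ℕ) : Set (Filling n) :=
  {P | P.IsParking ∧ P.IsColumnRestricted ∧ ∀ c, P.height c = k c}

/-- The map `τ`: car `m` is in column `j` iff label `j` wins round `m` of the tournament. -/
noncomputable def tau {n : ℕ} (T : TreeClass n) : Filling n :=
  fun m => @Classical.epsilon (Fin n) ⟨m⟩ fun j => T.WinsRound j m

/-! The proof is an induction on `n` in which the first round of a tournament corresponds to the
removal of car 1. The first pair to face off is the cherry (two leaves with a common neighbour)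
whose smaller label `i` is largest. Removing its two leaves and giving their neighbour the label
that advances yields a tree whose tournament is the rest of the original one, with the labels closed
up (`IsFirst.isTournament_iff_of_prunesTo`).

Two facts about tournaments are needed. The laziness rule forces the losers to decrease weakly
(`FacesOff.le_of_canFaceOff_advance`). By induction, the first loser then never wins and every
larger numeric label does (`exists_tournament`), so `i` is the largest label that is c or a zero of
`k`, and hence depends on `k` only. Secondly, `π_lazy` chooses the label to keep by `k_j` and not by
the laziness rule, but later rounds are unaffected (`IsFirst.exists_isTournament`): if `j` wins
again, it must have advanced; if not, a `j` that has advanced may be traded for `i` without changing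
any later round (`Run.relabel`).

For parking functions, the condition on car 1 says that its column is to the right of all empty
columns, and given this, `r` preserves and reflects all other conditions (`Filling.mem_CPF_iff`).
The label dropped by `π_lazy` is the number of the column deleted by `r` (`dropped_eq`), so the
square commutes (`IsFirst.toClass_mem_tour`).

Injectivity follows: the column `j` of car 1 and `k` determine `i` and the label kept, induction
determines the pruned tree, and grafting a cherry recovers the tree (`PrunesTo.equiv_of_equiv`). For
surjectivity a cherry is grafted onto the tree given by induction, and
`exists_tour_of_mem_tour_tilde` checks that it faces off first and that the tournament then goes on
as required. -/

namespace TrivalentTree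

variable {n : ℕ}

/-! ### Leaves and cherries. -/

theorem mem_of_closed (T : TrivalentTree n) {S : Set T.V} {a : T.V} (ha : a ∈ S)
    (hS : ∀ x ∈ S, ∀ y, T.G.Adj x y → y ∈ S) (x : T.V) : x ∈ S := by
  obtain ⟨p⟩ := T.isTree.connected.preconnected a x
  induction p with
  | nil => exact ha
  | cons h _ ih => exact ih (hS _ ha _ h)

theorem leaf_ne_leaf (T : TrivalentTree n) {x y : Label n} (h : x ≠ y) : T.leaf x ≠ T.leaf y :=
  fun h' => h (T.leaf_injective h')

theorem exists_adj_leaf (T : TrivalentTree n) (x : Label n) : ∃ v, T.G.Adj v (T.leaf x) := by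
  obtain ⟨v, hv⟩ := Set.ncard_eq_one.1 ((T.leaf_range (T.leaf x)).1 ⟨x, rfl⟩)
  have : v ∈ T.G.neighborSet (T.leaf x) := hv ▸ rfl
  exact ⟨v, SimpleGraph.Adj.symm this⟩

theorem eq_of_adj_leaf (T : TrivalentTree n) {x : Label n} {p q : T.V}
    (hp : T.G.Adj p (T.leaf x)) (hq : T.G.Adj q (T.leaf x)) : p = q := by
  obtain ⟨v, hv⟩ := Set.ncard_eq_one.1 ((T.leaf_range (T.leaf x)).1 ⟨x, rfl⟩)
  have h1 : p ∈ T.G.neighborSet (T.leaf x) := hp.symm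
  have h2 : q ∈ T.G.neighborSet (T.leaf x) := hq.symm
  rw [hv] at h1 h2
  exact h1.trans h2.symm

/-- Two adjacent leaves would form a whole component, but there are at least three leaves. -/
theorem not_adj_leaf_leaf (T : TrivalentTree n) (x y : Label n) :
    ¬ T.G.Adj (T.leaf x) (T.leaf y) := by
  intro h
  obtain ⟨z, hzx, hzy⟩ : ∃ z : Label n, z ≠ x ∧ z ≠ y := by
    by_contra! hc
    have h0 := hc ⟨0, by omega⟩
    have h1 := hc ⟨1, by omega⟩
    have h2 := hc ⟨2, by omega⟩
    simp only [Fin.ext_iff, ne_eq] at h0 h1 h2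
    omega
  have := T.mem_of_closed (S := {T.leaf x, T.leaf y}) (a := T.leaf x) (by simp) (by
    rintro p (rfl | rfl) q hq
    · exact Or.inr (T.eq_of_adj_leaf hq.symm h.symm)
    · exact Or.inl (T.eq_of_adj_leaf hq.symm h)) (T.leaf z)
  rcases this with h' | h'
  · exact hzx (T.leaf_injective h')
  · exact hzy (T.leaf_injective h')

theorem ne_leaf_of_adj (T : TrivalentTree n) {v : T.V} {x : Label n} (h : T.G.Adj v (T.leaf x))
    (y : Label n) : v ≠ T.leaf y := by
  rintro rfl
  exact T.not_adj_leaf_leaf _ _ h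

/-- The vertex `v` is adjacent to the leaves `i` and `j`, and its third neighbour is `w`. -/
structure IsCherry (T : TrivalentTree n) (v w : T.V) (i j : Label n) : Prop where
  ne : i ≠ j
  adj_left : T.G.Adj v (T.leaf i)
  adj_right : T.G.Adj v (T.leaf j)
  adj_third : T.G.Adj v w
  third_ne_left : w ≠ T.leaf i
  third_ne_right : w ≠ T.leaf j
  eq_of_adj : ∀ t, T.G.Adj v t → t = T.leaf i ∨ t = T.leaf j ∨ t = w

theorem exists_isCherry (T : TrivalentTree n) {v : T.V} {i j : Label n} (hij : i ≠ j)
    (hi : T.G.Adj v (T.leaf i)) (hj : T.G.Adj v (T.leaf j)) : ∃ w, T.IsCherry v w i j := by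
  have h3 : (T.G.neighborSet v).ncard = 3 :=
    (T.degree v).resolve_left fun h => by
      obtain ⟨x, rfl⟩ := (T.leaf_range v).2 h
      exact T.not_adj_leaf_leaf _ _ hi
  obtain ⟨x, y, z, hxy, hxz, hyz, h⟩ := Set.ncard_eq_three.1 h3
  have hN : ∀ t, T.G.Adj v t ↔ t = x ∨ t = y ∨ t = z := fun t => by
    rw [← SimpleGraph.mem_neighborSet, h]; simp
  have hne := T.leaf_ne_leaf hij
  have h1 := (hN _).1 hi
  have h2 := (hN _).1 hj
  have : ∃ w, T.G.Adj v w ∧ w ≠ T.leaf i ∧ w ≠ T.leaf j ∧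
      ∀ t, T.G.Adj v t → t = T.leaf i ∨ t = T.leaf j ∨ t = w := by
    simp only [hN]
    generalize T.leaf i = p at *
    generalize T.leaf j = q at *
    rcases h1 with rfl | rfl | rfl <;> rcases h2 with rfl | rfl | rfl
    · exact absurd rfl hne
    · exact ⟨z, by grind⟩
    · exact ⟨y, by grind⟩
    · exact ⟨z, by grind⟩
    · exact absurd rfl hne
    · exact ⟨x, by grind⟩
    · exact ⟨y, by grind⟩
    · exact ⟨x, by grind⟩
    · exact absurd rfl hne
  obtain ⟨w, hw, hwi, hwj, hall⟩ := this
  exact ⟨w, hij, hi, hj, hw, hwi, hwj, hall⟩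

namespace IsCherry

variable {T : TrivalentTree n} {v w : T.V} {i j : Label n}

theorem symm (h : T.IsCherry v w i j) : T.IsCherry v w j i :=
  ⟨h.ne.symm, h.adj_right, h.adj_left, h.adj_third, h.third_ne_right, h.third_ne_left,
    fun t ht => by rcases h.eq_of_adj t ht with h | h | h <;> simp [h]⟩

theorem ne_leaf (h : T.IsCherry v w i j) (y : Label n) : v ≠ T.leaf y :=
  T.ne_leaf_of_adj h.adj_left y

/-- Otherwise the tree would be a star with three leaves; size `n + 1` provides a fourth. -/
theorem third_ne_leaf {T : TrivalentTree (n + 1)} {v w : T.V} {i j : Label (n + 1)}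
    (h : T.IsCherry v w i j) (z : Label (n + 1)) : w ≠ T.leaf z := by
  rintro rfl
  obtain ⟨u, hui, huj, huz⟩ : ∃ u : Label (n + 1), u ≠ i ∧ u ≠ j ∧ u ≠ z := by
    by_contra! hc
    have h0 := hc ⟨0, by omega⟩
    have h1 := hc ⟨1, by omega⟩
    have h2 := hc ⟨2, by omega⟩
    have h3 := hc ⟨3, by omega⟩
    simp only [Fin.ext_iff, ne_eq] at h0 h1 h2 h3
    omega
  have := T.mem_of_closed (S := {v, T.leaf i, T.leaf j, T.leaf z}) (a := v) (by simp) (by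
    rintro p (rfl | rfl | rfl | rfl) q hq
    · rcases h.eq_of_adj _ hq with h | h | h <;> simp [h]
    · exact Or.inl (T.eq_of_adj_leaf hq.symm h.adj_left)
    · exact Or.inl (T.eq_of_adj_leaf hq.symm h.adj_right)
    · exact Or.inl (T.eq_of_adj_leaf hq.symm h.adj_third)) (T.leaf u)
  rcases this with h' | h' | h' | h'
  · exact h.ne_leaf u h'.symm
  · exact hui (T.leaf_injective h')
  · exact huj (T.leaf_injective h')
  · exact huz (T.leaf_injective h')

theorem eq_or_eq_or_eq {e : Sym2 T.V} (h : T.IsCherry v w i j) (he : e ∈ T.G.incidenceSet v) :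
    e = s(v, T.leaf i) ∨ e = s(v, T.leaf j) ∨ e = s(v, w) := by
  obtain ⟨he, hv⟩ := he
  obtain ⟨t, rfl⟩ := hv
  rcases h.eq_of_adj t he with rfl | rfl | rfl <;> simp

end IsCherry

/-! ### The initial labelling. -/

section Initial

theorem IsInitial.unique {T : TrivalentTree n} {lab lab' : T.EdgeLabeling} (h : T.IsInitial lab)
    (h' : T.IsInitial lab') : lab = lab' := by
  funext e
  exact Option.ext fun x => (h e x).trans (h' e x).symm

open Classical in
theorem exists_isInitial (T : TrivalentTree n) : ∃ lab, T.IsInitial lab := by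
  refine ⟨fun e => if h : ∃ x, e ∈ T.G.edgeSet ∧ T.leaf x ∈ e then some h.choose else none, ?_⟩
  intro e x
  by_cases h : ∃ x, e ∈ T.G.edgeSet ∧ T.leaf x ∈ e
  · simp only [h, ↓reduceDIte, Option.some.injEq]
    constructor
    · rintro rfl
      exact h.choose_spec
    · rintro ⟨he, hx⟩
      by_contra hne
      have h2 := h.choose_spec.2
      have := (Sym2.mem_and_mem_iff (T.leaf_ne_leaf hne)).1 ⟨h2, hx⟩
      rw [this] at he
      exact T.not_adj_leaf_leaf _ _ he
  · simp only [h, ↓reduceDIte, reduceCtorEq, false_iff]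
    exact fun h' => h ⟨x, h'⟩

variable {T : TrivalentTree n} {lab : T.EdgeLabeling}

theorem IsInitial.leaf_edge (h : T.IsInitial lab) {v : T.V} {x : Label n}
    (hv : T.G.Adj v (T.leaf x)) : lab s(v, T.leaf x) = some x :=
  (h _ _).2 ⟨hv, by simp⟩

theorem IsInitial.eq_none (h : T.IsInitial lab) {v w : T.V} (hv : ∀ x, v ≠ T.leaf x)
    (hw : ∀ x, w ≠ T.leaf x) : lab s(v, w) = none := by
  rw [Option.eq_none_iff_forall_ne_some]
  intro x hx
  rcases Sym2.mem_iff.1 ((h _ _).1 hx).2 with h' | h'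
  · exact hv x h'.symm
  · exact hw x h'.symm

theorem IsInitial.eq_leaf_edge (h : T.IsInitial lab) {v : T.V} {e : Sym2 T.V} {x : Label n}
    (hv : ∀ x, v ≠ T.leaf x) (he : v ∈ e) (hx : lab e = some x) :
    e = s(v, T.leaf x) ∧ T.G.Adj v (T.leaf x) := by
  obtain ⟨h1, h2⟩ := (h _ _).1 hx
  have := (Sym2.mem_and_mem_iff (hv x)).1 ⟨he, h2⟩
  subst this
  exact ⟨rfl, h1⟩

/-- Only leaf edges carry labels at the start, and with at least four leaves the third edge of a
cherry joins two inner vertices, so it is unlabelled. -/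
theorem IsInitial.canFaceOff_iff {T : TrivalentTree (n + 1)} {lab : T.EdgeLabeling}
    (h : T.IsInitial lab) {i j : Label (n + 1)} {E : Sym2 T.V} :
    T.CanFaceOff lab i j E ↔ i < j ∧ ∃ v w, T.IsCherry v w i j ∧ E = s(v, w) := by
  constructor
  · rintro ⟨hij, v, e, he, f, hf, hef, hE, h1, h2, h3⟩
    have hv : ∀ x, v ≠ T.leaf x := by
      rintro x rfl
      obtain ⟨he1, p, rfl⟩ := he
      obtain ⟨hf1, q, rfl⟩ := hf
      have : p = q := T.eq_of_adj_leaf (SimpleGraph.Adj.symm he1) (SimpleGraph.Adj.symm hf1)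
      exact hef (by rw [this])
    obtain ⟨rfl, hi⟩ := h.eq_leaf_edge hv he.2 h1
    obtain ⟨rfl, hj⟩ := h.eq_leaf_edge hv hf.2 h2
    obtain ⟨w, hw⟩ := T.exists_isCherry hij.ne hi hj
    refine ⟨hij, v, w, hw, ?_⟩
    rcases hw.eq_or_eq_or_eq hE with rfl | rfl | rfl
    · simp [h1] at h3
    · simp [h2] at h3
    · rfl
  · rintro ⟨hij, v, w, hw, rfl⟩
    refine ⟨hij, v, _, ⟨hw.adj_left, by simp⟩, _, ⟨hw.adj_right, by simp⟩, ?_,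
      ⟨hw.adj_third, by simp⟩, h.leaf_edge hw.adj_left, h.leaf_edge hw.adj_right,
      h.eq_none hw.ne_leaf hw.third_ne_leaf⟩
    intro he
    exact T.leaf_ne_leaf hij.ne (Sym2.congr_right.1 he)

/-- At `v` the only labels are `i` and `j`, which the conditions on `u` exclude, so only the end `w`
can trigger laziness. -/
theorem IsInitial.lazinessApplies_iff {T : TrivalentTree (n + 1)} {lab : T.EdgeLabeling}
    (h : T.IsInitial lab) {v w : T.V} {i j : Label (n + 1)} (hc : T.IsCherry v w i j) :
    T.LazinessApplies lab i j s(v, w) ↔ ∃ u, T.G.Adj w (T.leaf u) ∧ u ≠ j ∧ i < u := by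
  constructor
  · rintro ⟨g, hg, hgE, ⟨p, hp, hpg⟩, u, hu, huj, hiu⟩
    rcases Sym2.mem_iff.1 hp with rfl | rfl
    · obtain ⟨-, hu'⟩ := h.eq_leaf_edge hc.ne_leaf hpg hu
      rcases hc.eq_of_adj _ hu' with h' | h' | h'
      · exact absurd (T.leaf_injective h') hiu.ne'
      · exact absurd (T.leaf_injective h') huj
      · exact absurd h'.symm (hc.third_ne_leaf u)
    · exact ⟨u, (h.eq_leaf_edge hc.third_ne_leaf hpg hu).2, huj, hiu⟩
  · rintro ⟨u, hu, huj, hiu⟩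
    refine ⟨s(w, T.leaf u), hu, ?_, ⟨w, by simp, by simp⟩, u, h.leaf_edge hu, huj, hiu⟩
    intro he
    rw [Sym2.eq_swap, Sym2.congr_left] at he
    exact hc.ne_leaf u he.symm

end Initial

/-! ### Counting vertices and finding a cherry without a or b. -/

section Counting

theorem card_vertices (T : TrivalentTree n) : Nat.card T.V + 2 = 2 * (n + 3) := by
  classical
  have := T.finite
  have := Fintype.ofFinite T.V
  have h1 := T.G.sum_degrees_eq_twice_card_edges
  have h2 := T.isTree.card_edgeFinset
  have hd : ∀ v, T.G.degree v = (T.G.neighborSet v).ncard := fun v => by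
    rw [← SimpleGraph.card_neighborSet_eq_degree, Set.ncard_eq_toFinset_card',
      Set.toFinset_card]
  -- A leaf has degree `1 = 3 - 2` and any other vertex degree `3`; summing compares the number of
  -- leaves with twice the number of edges.
  have h3 : ∀ v, T.G.degree v + 2 * (if ∃ x, T.leaf x = v then 1 else 0) = 3 := fun v => by
    rw [hd]
    simp only [T.leaf_range]
    rcases T.degree v with h | h <;> simp [h]
  have h4 : ∑ v, (T.G.degree v + 2 * (if ∃ x, T.leaf x = v then 1 else 0)) =
      Fintype.card T.V * 3 := by
    simp only [h3, Finset.sum_const, Finset.card_univ, smul_eq_mul]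
  have h5 : (Finset.univ.filter fun v => ∃ x, T.leaf x = v).card = n + 3 := by
    have : (Finset.univ.filter fun v => ∃ x, T.leaf x = v) = Finset.univ.image T.leaf := by
      ext v; simp
    rw [this, Finset.card_image_of_injective _ T.leaf_injective]
    simp
  rw [Finset.sum_add_distrib, ← Finset.mul_sum, Finset.sum_boole, h5, h1] at h4
  rw [Nat.card_eq_fintype_card]
  simp only [Nat.cast_id] at h4
  omega

/-- Pigeonhole: the `n + 2` leaves other than a and b hang from the `n + 1` inner vertices other
than the neighbour of a and b. -/
theorem exists_isCherry_ge_two (T : TrivalentTree (n + 1)) (hT : T.ABShareVertex) :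
    ∃ v w i j, 2 ≤ i.val ∧ i < j ∧ T.IsCherry v w i j := by
  classical
  have := T.finite
  have := Fintype.ofFinite T.V
  have hcard := T.card_vertices
  rw [Nat.card_eq_fintype_card] at hcard
  obtain ⟨o, ha, hb⟩ := hT
  choose nb hnb using T.exists_adj_leaf
  obtain ⟨o', ho⟩ := T.exists_isCherry (by simp) ha hb
  let S : Finset (Label (n + 1)) := Finset.univ.filter fun x => 2 ≤ x.val
  let U : Finset T.V := (Finset.univ.image T.leaf ∪ {o})ᶜ
  have hS : S.card = n + 2 := by
    have : S = Finset.Ici ⟨2, by omega⟩ := by ext; simp [S, Fin.le_def]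
    rw [this, Fin.card_Ici]
    simp
  have hU : U.card = n + 1 := by
    rw [Finset.card_compl, Finset.card_union_of_disjoint, Finset.card_singleton,
      Finset.card_image_of_injective _ T.leaf_injective]
    · simp; omega
    · simp only [Finset.disjoint_singleton_right, Finset.mem_image, not_exists]
      rintro x ⟨-, h⟩
      exact ho.ne_leaf x h.symm
  obtain ⟨x, hx, y, hy, hxy, he⟩ := Finset.exists_ne_map_eq_of_card_lt_of_maps_to
    (s := S) (t := U) (f := nb) (by omega) (by
      intro x hx
      simp only [U, Finset.coe_compl, Set.mem_compl_iff, Finset.mem_coe, Finset.mem_union,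
        Finset.mem_image, Finset.mem_singleton, not_or, not_exists]
      refine ⟨fun y hy => T.ne_leaf_of_adj (hnb x) y hy.2.symm, fun h => ?_⟩
      have h2 : 2 ≤ x.val := (Finset.mem_filter.1 hx).2
      have := hnb x
      rw [h] at this
      rcases ho.eq_of_adj _ this with h | h | h
      · rw [T.leaf_injective h] at h2
        simp at h2
      · rw [T.leaf_injective h] at h2
        simp at h2
      · exact ho.third_ne_leaf x h.symm)
  have hx : 2 ≤ x.val := (Finset.mem_filter.1 hx).2
  have hy : 2 ≤ y.val := (Finset.mem_filter.1 hy).2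
  obtain ⟨w, hw⟩ := T.exists_isCherry hxy (hnb x) (he ▸ hnb y)
  rcases lt_or_gt_of_ne hxy with h | h
  · exact ⟨_, w, x, y, hx, h, hw⟩
  · exact ⟨_, w, y, x, hy, h, hw.symm⟩

end Counting

end TrivalentTree

namespace TrivalentTree

variable {n : ℕ}

/-! ### Changing the label of one edge; monotonicity of losers. -/

section Relabel

variable {T : TrivalentTree n} {lab : T.EdgeLabeling} {E e : Sym2 T.V} {x i j : Label n}

open Classical in
/-- The labelling that gives the edge `E` the label `x` and otherwise agrees with `lab`. -/
noncomputable def relabel (T : TrivalentTree n) (lab : T.EdgeLabeling) (E : Sym2 T.V)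
    (x : Label n) : T.EdgeLabeling :=
  fun e => if e = E then some x else lab e

theorem relabel_self : T.relabel lab E x E = some x := if_pos rfl

theorem relabel_of_ne (h : e ≠ E) : T.relabel lab E x e = lab e := if_neg h

theorem relabel_eq_none (h : T.relabel lab E x e = none) : e ≠ E ∧ lab e = none := by
  by_cases he : e = E
  · subst he; simp [relabel_self] at h
  · exact ⟨he, by rwa [relabel_of_ne he] at h⟩

theorem relabel_comm {F : Sym2 T.V} {y : Label n} (h : E ≠ F) :
    T.relabel (T.relabel lab E x) F y = T.relabel (T.relabel lab F y) E x := by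
  funext e
  unfold relabel
  by_cases he : e = E
  · have : e ≠ F := he ▸ h
    simp [he, h]
  · simp [he]

theorem advance_of_laziness (h : T.LazinessApplies lab i j E) :
    T.advance lab i j E = T.relabel lab E i := by
  unfold advance relabel
  simp only [h, if_true]

theorem advance_of_not_laziness (h : ¬ T.LazinessApplies lab i j E) :
    T.advance lab i j E = T.relabel lab E j := by
  unfold advance relabel
  simp only [h, if_false]

theorem exists_advance_eq (lab : T.EdgeLabeling) (i j : Label n) (E : Sym2 T.V) :
    ∃ x, (x = i ∨ x = j) ∧ T.advance lab i j E = T.relabel lab E x := by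
  by_cases h : T.LazinessApplies lab i j E
  · exact ⟨i, Or.inl rfl, advance_of_laziness h⟩
  · exact ⟨j, Or.inr rfl, advance_of_not_laziness h⟩

theorem CanFaceOff.exists_adjacent (h : T.CanFaceOff lab i j E) :
    E ∈ T.G.edgeSet ∧ lab E = none ∧
      (∃ e ∈ T.G.edgeSet, lab e = some i ∧ ∃ v, v ∈ e ∧ v ∈ E) ∧
      ∃ f ∈ T.G.edgeSet, lab f = some j ∧ ∃ v, v ∈ f ∧ v ∈ E := by
  obtain ⟨_, v, e, he, f, hf, _, hE, h1, h2, h3⟩ := h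
  exact ⟨hE.1, h3, ⟨e, he.1, h1, v, he.2, hE.2⟩, f, hf.1, h2, v, hf.2, hE.2⟩

/-- The losers of successive rounds weakly decrease. -/
theorem FacesOff.le_of_canFaceOff_advance (h : T.FacesOff lab i j E) {i' j' : Label n}
    {E' : Sym2 T.V} (h' : T.CanFaceOff (T.advance lab i j E) i' j' E') : i' ≤ i := by
  obtain ⟨hij, v, e, he, f, hf, hef, hE, h1, h2, h3⟩ := h'
  -- If `i` advances, a pair that uses `E` contains `i`, so its smaller label is at most `i`; every
  -- other pair was available before.
  by_cases hl : T.LazinessApplies lab i j E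
  · rw [advance_of_laziness hl] at h1 h2 h3
    obtain ⟨hne, h3⟩ := relabel_eq_none h3
    by_cases heE : e = E
    · subst heE
      rw [relabel_self] at h1
      exact (Option.some.inj h1).ge
    · rw [relabel_of_ne heE] at h1
      by_cases hfE : f = E
      · subst hfE
        rw [relabel_self] at h2
        exact ((Option.some.inj h2) ▸ hij).le
      · rw [relabel_of_ne hfE] at h2
        exact h.2 i' j' E' ⟨hij, v, e, he, f, hf, hef, hE, h1, h2, h3⟩
  · have hl' := hl
    rw [advance_of_not_laziness hl] at h1 h2 h3
    obtain ⟨hne, h3⟩ := relabel_eq_none h3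
    -- If `j` advances, laziness has failed, so next to `E` all labels other than `j` are at most
    -- `i`. This bounds every pair that uses `E`.
    have key : ∀ g ∈ T.G.incidenceSet v, ∀ u, g ≠ E → v ∈ E → lab g = some u → u ≠ j → u ≤ i :=
      fun g hg u hgE hv hu huj => not_lt.1 fun hiu =>
        hl ⟨g, hg.1, hgE, ⟨v, hv, hg.2⟩, u, hu, huj, hiu⟩
    by_cases heE : e = E
    · subst heE
      rw [relabel_self] at h1
      have hi := Option.some.inj h1
      rw [relabel_of_ne (Ne.symm hef)] at h2
      exact hij.le.trans (key f hf j' (Ne.symm hef) he.2 h2 (hi ▸ hij.ne'))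
    · rw [relabel_of_ne heE] at h1
      by_cases hfE : f = E
      · subst hfE
        rw [relabel_self] at h2
        have hj := Option.some.inj h2
        exact key e he i' heE hf.2 h1 (hj ▸ hij.ne)
      · rw [relabel_of_ne hfE] at h2
        exact h.2 i' j' E' ⟨hij, v, e, he, f, hf, hef, hE, h1, h2, h3⟩

/-- If the label `j` on the edge `E` takes no part in a run any more, other than by its presence,
it may be replaced by a smaller label `i` that exceeds all labels still to lose. -/
theorem Run.relabel {rs : List (Label n × Label n)} (hij : i < j) (h : T.Run lab rs)
    (hE : lab E = some j)
    (hdead : ∀ g ∈ T.G.edgeSet, g ≠ E → lab g = some i ∨ lab g = some j →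
      ∀ F ∈ T.G.edgeSet, (∃ v, v ∈ g ∧ v ∈ F) → lab F ≠ none)
    (hlt : ∀ x y F, T.CanFaceOff lab x y F → x < i) (hrs : ∀ p ∈ rs, p.2 ≠ j) :
    T.Run (T.relabel lab E i) rs := by
  induction h with
  | done lab h =>
    exact Run.done _ fun e he h' => h e he (relabel_eq_none h').2
  | round lab x y F rs h _ ih =>
    have hyj : y ≠ j := hrs (x, y) (by simp)
    have hxi : x < i := hlt _ _ _ h.1
    -- An edge labelled `i` cannot win: it is not `E`, which carries `j`, and any other such edge
    -- has no unlabelled neighbour.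
    have hyi : y ≠ i := by
      rintro rfl
      obtain ⟨hF, hF0, -, g, hg, hgy, hv⟩ := h.1.exists_adjacent
      refine hdead g hg ?_ (Or.inl hgy) F hF hv hF0
      rintro rfl
      rw [hE] at hgy
      exact hyj (Option.some.inj hgy).symm
    have hFE : E ≠ F := by
      rintro rfl
      have := h.1.exists_adjacent.2.1
      simp [hE] at this
    have hface : T.FacesOff (T.relabel lab E i) x y F := by
      constructor
      · obtain ⟨hxy, v, e, he, f, hf, hef, hF, h1, h2, h3⟩ := h.1
        refine ⟨hxy, v, e, he, f, hf, hef, hF, ?_, ?_, ?_⟩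
        · rwa [relabel_of_ne]
          rintro rfl
          rw [hE] at h1
          exact (hxi.trans hij).ne (Option.some.inj h1).symm
        · rwa [relabel_of_ne]
          rintro rfl
          rw [hE] at h2
          exact hyj (Option.some.inj h2).symm
        · rwa [relabel_of_ne hFE.symm]
      · rintro x' y' F' ⟨hxy, v, e, he, f, hf, hef, hF, h1, h2, h3⟩
        obtain ⟨hF'E, h0⟩ := relabel_eq_none h3
        by_cases heE : e = E
        · subst heE
          rw [relabel_self] at h1
          obtain rfl := Option.some.inj h1
          rw [relabel_of_ne (Ne.symm hef)] at h2
          -- `E` would now play as `i` against a larger `y'`. Before the change these edges carried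
          -- `j` and `y'`, both above `i`: if the labels differ, they form an available pair that
          -- `hlt` forbids; if they agree, `hdead` applies to `f`.
          rcases lt_trichotomy j y' with hj | rfl | hj
          · exact absurd (hlt _ _ _ ⟨hj, v, e, he, f, hf, hef, hF, hE, h2, h0⟩) hij.not_gt
          · exact absurd h0 (hdead f hf.1 (Ne.symm hef) (Or.inr h2) F' hF.1 ⟨v, hf.2, hF.2⟩)
          · exact absurd (hlt _ _ _ ⟨hj, v, f, hf, e, he, Ne.symm hef, hF, h2, hE, h0⟩)
              hxy.not_gt
        · rw [relabel_of_ne heE] at h1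
          by_cases hfE : f = E
          · subst hfE
            rw [relabel_self] at h2
            obtain rfl := Option.some.inj h2
            exact h.2 _ _ _ ⟨hxy.trans hij, v, e, he, f, hf, hef, hF, h1, hE, h0⟩
          · rw [relabel_of_ne hfE] at h2
            exact h.2 _ _ _ ⟨hxy, v, e, he, f, hf, hef, hF, h1, h2, h0⟩
    -- Both `i` and `j` exceed the loser `x` and differ from the winner `y`, so on `E` they trigger
    -- laziness alike.
    have hlazy : T.LazinessApplies (T.relabel lab E i) x y F ↔ T.LazinessApplies lab x y F := by
      constructor
      · rintro ⟨g, hg, hgF, hw, u, hu, huy, hxu⟩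
        by_cases hgE : g = E
        · exact ⟨g, hg, hgF, hw, j, hgE ▸ hE, hyj.symm, hxi.trans hij⟩
        · exact ⟨g, hg, hgF, hw, u, by rwa [relabel_of_ne hgE] at hu, huy, hxu⟩
      · rintro ⟨g, hg, hgF, hw, u, hu, huy, hxu⟩
        by_cases hgE : g = E
        · exact ⟨g, hg, hgF, hw, i, hgE ▸ relabel_self, hyi.symm, hxi⟩
        · exact ⟨g, hg, hgF, hw, u, by rwa [relabel_of_ne hgE], huy, hxu⟩
    obtain ⟨z, hz, hadv⟩ := exists_advance_eq lab x y F
    have hadv' : T.advance (T.relabel lab E i) x y F = T.relabel (T.advance lab x y F) E i := by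
      by_cases hl : T.LazinessApplies lab x y F
      · rw [advance_of_laziness hl, advance_of_laziness (hlazy.2 hl), relabel_comm hFE]
      · rw [advance_of_not_laziness hl, advance_of_not_laziness (mt hlazy.1 hl),
          relabel_comm hFE]
    refine Run.round _ x y F rs hface ?_
    rw [hadv']
    refine ih ?_ ?_ ?_ fun p hp => hrs p (List.mem_cons_of_mem _ hp)
    · rw [hadv, relabel_of_ne hFE, hE]
    · intro g hg hgE hl F' hF' hv h0
      rw [hadv] at hl h0
      obtain ⟨hF'F, h0⟩ := relabel_eq_none h0
      by_cases hgF : g = F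
      · subst hgF
        rw [relabel_self, Option.some.injEq, Option.some.injEq] at hl
        rcases hz with rfl | rfl
        · rcases hl with rfl | rfl
          · exact lt_irrefl _ hxi
          · exact lt_asymm hxi hij
        · exact hl.elim hyi hyj
      · rw [relabel_of_ne hgF] at hl
        exact hdead g hg hgE hl F' hF' hv h0
    · exact fun x' y' F' h' => (h.le_of_canFaceOff_advance h').trans_lt hxi

end Relabel

/-- `φ` embeds `B` in `A` as what is left when the leaves `keep` and `drop` next to `v` are
removed, and `v` gets the label `keep`. -/
structure PrunesTo (A : TrivalentTree (n + 1)) (v w : A.V) (keep drop : Label (n + 1))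
    (B : TrivalentTree n) (φ : B.G ↪g A.G) : Prop where
  cherry : A.IsCherry v w keep drop
  range_eq : Set.range φ = {w | w ≠ A.leaf keep ∧ w ≠ A.leaf drop}
  map_leaf : ∀ y, φ (B.leaf y) =
    if drop.succAbove y = keep then v else A.leaf (drop.succAbove y)

/-! ### Comparing the tournaments of a tree and of a pruned tree. -/

namespace PrunesTo

variable {A : TrivalentTree (n + 1)} {v w : A.V} {keep drop : Label (n + 1)}
  {B : TrivalentTree n} {φ : B.G ↪g A.G}

theorem ne_keep (h : A.PrunesTo v w keep drop B φ) (u : B.V) : φ u ≠ A.leaf keep :=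
  (h.range_eq ▸ Set.mem_range_self u : φ u ∈ {w | w ≠ A.leaf keep ∧ w ≠ A.leaf drop}).1

theorem ne_drop (h : A.PrunesTo v w keep drop B φ) (u : B.V) : φ u ≠ A.leaf drop :=
  (h.range_eq ▸ Set.mem_range_self u : φ u ∈ {w | w ≠ A.leaf keep ∧ w ≠ A.leaf drop}).2

theorem exists_eq (h : A.PrunesTo v w keep drop B φ) {u : A.V} (h1 : u ≠ A.leaf keep)
    (h2 : u ≠ A.leaf drop) : ∃ u', φ u' = u := by
  have : u ∈ Set.range φ := by rw [h.range_eq]; exact ⟨h1, h2⟩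
  exact this

theorem exists_succAbove_eq (h : A.PrunesTo v w keep drop B φ) :
    ∃ y, drop.succAbove y = keep ∧ φ (B.leaf y) = v := by
  obtain ⟨y, hy⟩ := Fin.exists_succAbove_eq h.cherry.ne
  exact ⟨y, hy, by rw [h.map_leaf, if_pos hy]⟩

theorem map_leaf_of_ne (h : A.PrunesTo v w keep drop B φ) {y : Label n}
    (hy : drop.succAbove y ≠ keep) : φ (B.leaf y) = A.leaf (drop.succAbove y) := by
  rw [h.map_leaf, if_neg hy]

theorem map_mem_edgeSet {e : Sym2 B.V} (he : e ∈ B.G.edgeSet) : e.map φ ∈ A.G.edgeSet := by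
  induction e with
  | _ x y => exact φ.map_adj_iff.2 he

theorem map_mem_incidenceSet {u : B.V} {e : Sym2 B.V} (he : e ∈ B.G.incidenceSet u) :
    e.map φ ∈ A.G.incidenceSet (φ u) :=
  ⟨map_mem_edgeSet he.1, Sym2.mem_map.2 ⟨u, he.2, rfl⟩⟩

theorem exists_adj_eq (h : A.PrunesTo v w keep drop B φ) {u : B.V} (hu : φ u ≠ v) {t : A.V}
    (ht : A.G.Adj (φ u) t) : ∃ t', B.G.Adj u t' ∧ φ t' = t := by
  obtain ⟨t', rfl⟩ := h.exists_eq (u := t)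
    (fun h' => hu (A.eq_of_adj_leaf (h' ▸ ht) h.cherry.adj_left))
    (fun h' => hu (A.eq_of_adj_leaf (h' ▸ ht) h.cherry.adj_right))
  exact ⟨t', φ.map_adj_iff.1 ht, rfl⟩

theorem exists_incidence_eq (h : A.PrunesTo v w keep drop B φ) {u : B.V} (hu : φ u ≠ v)
    {e : Sym2 A.V} (he : e ∈ A.G.incidenceSet (φ u)) :
    ∃ e' ∈ B.G.incidenceSet u, e'.map φ = e := by
  obtain ⟨he, t, rfl⟩ := he
  obtain ⟨t', ht', rfl⟩ := h.exists_adj_eq hu he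
  exact ⟨s(u, t'), ⟨ht', by simp⟩, by simp⟩

/-- A labelling of `A` restricts to a labelling of `B`, and has no unlabelled edge at `v`. -/
structure Restricts (h : A.PrunesTo v w keep drop B φ) (lab : A.EdgeLabeling)
    (lab' : B.EdgeLabeling) : Prop where
  map_eq : ∀ e, lab (e.map φ) = (lab' e).map drop.succAbove
  ne_none : ∀ e ∈ A.G.incidenceSet v, lab e ≠ none

namespace Restricts

variable {h : A.PrunesTo v w keep drop B φ} {lab : A.EdgeLabeling} {lab' : B.EdgeLabeling}

/-- All edges at `v`, including those of the two removed leaves, are labelled. Hence whatever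
happens near an unlabelled edge takes place inside `B`. -/
theorem exists_vertex (hr : h.Restricts lab lab') {u : A.V} {E : Sym2 A.V}
    (hE : E ∈ A.G.incidenceSet u) (h0 : lab E = none) : ∃ u', φ u' = u ∧ φ u' ≠ v := by
  have huv : u ≠ v := by
    rintro rfl
    exact hr.ne_none E hE h0
  have key : ∀ x, A.G.Adj v (A.leaf x) → u ≠ A.leaf x := by
    rintro x hx rfl
    obtain ⟨hE, t, rfl⟩ := hE
    obtain rfl : t = v := A.eq_of_adj_leaf (SimpleGraph.Adj.symm hE) hx
    exact hr.ne_none _ ⟨hE, by simp⟩ h0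
  obtain ⟨u', rfl⟩ := h.exists_eq (key _ h.cherry.adj_left) (key _ h.cherry.adj_right)
  exact ⟨u', rfl, huv⟩

theorem eq_none_iff (hr : h.Restricts lab lab') {e : Sym2 B.V} :
    lab (e.map φ) = none ↔ lab' e = none := by
  rw [hr.map_eq, Option.map_eq_none_iff]

theorem eq_some_iff (hr : h.Restricts lab lab') {e : Sym2 B.V} {x : Label n} :
    lab (e.map φ) = some (drop.succAbove x) ↔ lab' e = some x := by
  rw [hr.map_eq, Option.map_eq_some_iff]
  exact ⟨fun ⟨a, ha, hx⟩ => Fin.succAbove_right_injective hx ▸ ha, fun hx => ⟨x, hx, rfl⟩⟩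

theorem exists_eq_some (hr : h.Restricts lab lab') {e : Sym2 B.V} {x : Label (n + 1)}
    (hx : lab (e.map φ) = some x) : ∃ x', drop.succAbove x' = x ∧ lab' e = some x' := by
  rw [hr.map_eq, Option.map_eq_some_iff] at hx
  obtain ⟨x', h1, h2⟩ := hx
  exact ⟨x', h2, h1⟩

theorem canFaceOff (hr : h.Restricts lab lab') {x y : Label n} {E : Sym2 B.V}
    (hc : B.CanFaceOff lab' x y E) :
    A.CanFaceOff lab (drop.succAbove x) (drop.succAbove y) (E.map φ) := by
  obtain ⟨hxy, u, e, he, f, hf, hef, hE, h1, h2, h3⟩ := hc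
  exact ⟨Fin.succAbove_lt_succAbove_iff.2 hxy, φ u, _, map_mem_incidenceSet he, _,
    map_mem_incidenceSet hf, fun h' => hef (Sym2.map.injective φ.injective h'),
    map_mem_incidenceSet hE, hr.eq_some_iff.2 h1, hr.eq_some_iff.2 h2, hr.eq_none_iff.2 h3⟩

theorem exists_canFaceOff (hr : h.Restricts lab lab') {x y : Label (n + 1)} {E : Sym2 A.V}
    (hc : A.CanFaceOff lab x y E) : ∃ x' y' E', drop.succAbove x' = x ∧ drop.succAbove y' = y ∧
      E'.map φ = E ∧ B.CanFaceOff lab' x' y' E' := by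
  obtain ⟨hxy, u, e, he, f, hf, hef, hE, h1, h2, h3⟩ := hc
  obtain ⟨u, rfl, hu⟩ := hr.exists_vertex hE h3
  obtain ⟨e, he', rfl⟩ := h.exists_incidence_eq hu he
  obtain ⟨f, hf', rfl⟩ := h.exists_incidence_eq hu hf
  obtain ⟨E, hE', rfl⟩ := h.exists_incidence_eq hu hE
  obtain ⟨x, rfl, h1'⟩ := hr.exists_eq_some h1
  obtain ⟨y, rfl, h2'⟩ := hr.exists_eq_some h2
  exact ⟨x, y, E, rfl, rfl, rfl, Fin.succAbove_lt_succAbove_iff.1 hxy, u, e, he', f, hf',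
    fun h' => hef (h' ▸ rfl), hE', h1', h2', hr.eq_none_iff.1 h3⟩

/-- `drop.succAbove` is strictly increasing, so it respects the choice of the largest smaller label.
-/
theorem facesOff_iff (hr : h.Restricts lab lab') {x y : Label n} {E : Sym2 B.V} :
    A.FacesOff lab (drop.succAbove x) (drop.succAbove y) (E.map φ) ↔ B.FacesOff lab' x y E := by
  constructor
  · rintro ⟨hc, hmax⟩
    obtain ⟨x', y', E', hx, hy, hE, hc'⟩ := hr.exists_canFaceOff hc
    obtain rfl := Fin.succAbove_right_injective hx
    obtain rfl := Fin.succAbove_right_injective hy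
    obtain rfl := Sym2.map.injective φ.injective hE
    exact ⟨hc', fun i' j' E' h' =>
      Fin.succAbove_le_succAbove_iff.1 (hmax _ _ _ (hr.canFaceOff h'))⟩
  · rintro ⟨hc, hmax⟩
    refine ⟨hr.canFaceOff hc, fun i' j' E' h' => ?_⟩
    obtain ⟨x', y', E', rfl, rfl, rfl, hc'⟩ := hr.exists_canFaceOff h'
    exact Fin.succAbove_le_succAbove_iff.2 (hmax _ _ _ hc')

/-- As `E` is unlabelled, neither of its ends is `v`, so every edge adjacent to it comes from `B`.
-/
theorem lazinessApplies_iff (hr : h.Restricts lab lab') {x y : Label n} {E : Sym2 B.V}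
    (hE : E ∈ B.G.edgeSet) (h0 : lab' E = none) :
    A.LazinessApplies lab (drop.succAbove x) (drop.succAbove y) (E.map φ) ↔
      B.LazinessApplies lab' x y E := by
  constructor
  · rintro ⟨g, hg, hgE, ⟨p, hp, hpg⟩, u, hu, huy, hxu⟩
    obtain ⟨p, rfl, hpv⟩ := hr.exists_vertex ⟨map_mem_edgeSet hE, hp⟩ (hr.eq_none_iff.2 h0)
    obtain ⟨g, hg', rfl⟩ := h.exists_incidence_eq hpv ⟨hg, hpg⟩
    obtain ⟨u, rfl, hu'⟩ := hr.exists_eq_some hu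
    obtain ⟨p', hp', he⟩ := Sym2.mem_map.1 hp
    obtain rfl := φ.injective he
    exact ⟨g, hg'.1, fun h' => hgE (h' ▸ rfl), ⟨p', hp', hg'.2⟩, u, hu', fun h' => huy (h' ▸ rfl),
      Fin.succAbove_lt_succAbove_iff.1 hxu⟩
  · rintro ⟨g, hg, hgE, ⟨p, hp, hpg⟩, u, hu, huy, hxu⟩
    exact ⟨g.map φ, map_mem_edgeSet hg, fun h' => hgE (Sym2.map.injective φ.injective h'),
      ⟨φ p, Sym2.mem_map.2 ⟨p, hp, rfl⟩, Sym2.mem_map.2 ⟨p, hpg, rfl⟩⟩, _, hr.eq_some_iff.2 hu,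
      fun h' => huy (Fin.succAbove_right_injective h'), Fin.succAbove_lt_succAbove_iff.2 hxu⟩

theorem relabel (hr : h.Restricts lab lab') (x : Label n) (E : Sym2 B.V) :
    h.Restricts (A.relabel lab (E.map φ) (drop.succAbove x)) (B.relabel lab' E x) := by
  constructor
  · intro e
    by_cases he : e = E
    · rw [he, relabel_self, relabel_self, Option.map_some]
    · have he' : e.map φ ≠ E.map φ := fun h' => he (Sym2.map.injective φ.injective h')
      rw [relabel_of_ne he, relabel_of_ne he', hr.map_eq]
  · exact fun e he h' => hr.ne_none e he (relabel_eq_none h').2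

theorem advance (hr : h.Restricts lab lab') {x y : Label n} {E : Sym2 B.V}
    (hE : E ∈ B.G.edgeSet) (h0 : lab' E = none) :
    h.Restricts (A.advance lab (drop.succAbove x) (drop.succAbove y) (E.map φ))
      (B.advance lab' x y E) := by
  have hiff := hr.lazinessApplies_iff (x := x) (y := y) hE h0
  by_cases hl : B.LazinessApplies lab' x y E
  · rw [advance_of_laziness hl, advance_of_laziness (hiff.2 hl)]
    exact hr.relabel x E
  · rw [advance_of_not_laziness hl, advance_of_not_laziness (mt hiff.1 hl)]
    exact hr.relabel y E

theorem run (hr : h.Restricts lab lab') {rs : List (Label n × Label n)} (hrun : B.Run lab' rs) :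
    A.Run lab (rs.map (Prod.map drop.succAbove drop.succAbove)) := by
  induction hrun generalizing lab with
  | done lab' h' =>
    refine Run.done _ fun e he h0 => ?_
    induction e with
    | _ p q =>
      obtain ⟨p, rfl, hp⟩ := hr.exists_vertex (u := p) ⟨he, by simp⟩ h0
      obtain ⟨e, he', hee⟩ := h.exists_incidence_eq hp ⟨he, by simp⟩
      rw [← hee, hr.eq_none_iff] at h0
      exact h' e he'.1 h0
  | round lab' x y E rs hf _ ih =>
    obtain ⟨hE, h0, -⟩ := hf.1.exists_adjacent
    exact Run.round _ _ _ (E.map φ) _ (hr.facesOff_iff.2 hf) (ih (hr.advance hE h0))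

theorem exists_run (hr : h.Restricts lab lab') {rs : List (Label (n + 1) × Label (n + 1))}
    (hrun : A.Run lab rs) :
    ∃ rs', rs = rs'.map (Prod.map drop.succAbove drop.succAbove) ∧ B.Run lab' rs' := by
  induction hrun generalizing lab' with
  | done lab h' =>
    exact ⟨[], rfl, Run.done _ fun e he h0 => h' _ (map_mem_edgeSet he) (hr.eq_none_iff.2 h0)⟩
  | round lab x y E rs hf _ ih =>
    obtain ⟨x, y, E, rfl, rfl, rfl, hc⟩ := hr.exists_canFaceOff hf.1
    obtain ⟨hE, h0, -⟩ := hc.exists_adjacent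
    obtain ⟨rs', rfl, hrun⟩ := ih (hr.advance hE h0)
    exact ⟨(x, y) :: rs', rfl, Run.round _ _ _ E _ (hr.facesOff_iff.1 hf) hrun⟩

end Restricts

theorem mem_edgeSet_of_map {e : Sym2 B.V} (he : e.map φ ∈ A.G.edgeSet) : e ∈ B.G.edgeSet := by
  induction e with
  | _ x y => exact φ.map_adj_iff.1 he

theorem restricts (h : A.PrunesTo v w keep drop B φ) {lab : A.EdgeLabeling}
    {lab' : B.EdgeLabeling} (h0 : A.IsInitial lab) (h0' : B.IsInitial lab') :
    h.Restricts (A.relabel lab s(v, w) keep) lab' := by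
  obtain ⟨y, hy, hyv⟩ := h.exists_succAbove_eq
  constructor
  · intro e
    -- In `B` this is the edge of the new leaf, whose label `y` corresponds to `keep`. It is inner
    -- in `A` and receives `keep` in the first round.
    by_cases he : e.map φ = s(v, w)
    · have : lab' e = some y := by
        rw [h0']
        have hv : v ∈ e.map φ := by rw [he]; simp
        obtain ⟨u, hu, huv⟩ := Sym2.mem_map.1 hv
        obtain rfl : u = B.leaf y := φ.injective (huv.trans hyv.symm)
        exact ⟨mem_edgeSet_of_map (φ := φ) (he ▸ h.cherry.adj_third), hu⟩
      rw [he, relabel_self, this, Option.map_some, hy]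
    · rw [relabel_of_ne he]
      refine Option.ext fun x => ?_
      rw [h0, Option.map_eq_some_iff]
      simp only [h0' _ _]
      constructor
      · rintro ⟨hedge, hx⟩
        obtain ⟨u, hu, hux⟩ := Sym2.mem_map.1 hx
        have hxk : x ≠ keep := fun h' => h.ne_keep u (h' ▸ hux)
        have hxd : x ≠ drop := fun h' => h.ne_drop u (h' ▸ hux)
        obtain ⟨x', rfl⟩ := Fin.exists_succAbove_eq hxd
        rw [← h.map_leaf_of_ne hxk] at hux
        exact ⟨x', ⟨mem_edgeSet_of_map hedge, φ.injective hux ▸ hu⟩, rfl⟩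
      · rintro ⟨x', ⟨hedge, hx⟩, rfl⟩
        have hmem : φ (B.leaf x') ∈ e.map φ := Sym2.mem_map.2 ⟨_, hx, rfl⟩
        refine ⟨map_mem_edgeSet hedge, ?_⟩
        by_cases hk : drop.succAbove x' = keep
        · exfalso
          rw [h.map_leaf, if_pos hk] at hmem
          have key : ∀ t, (∀ u, φ u ≠ t) → e.map φ ≠ s(v, t) := by
            intro t ht he'
            have : t ∈ e.map φ := by rw [he']; simp
            obtain ⟨u, -, hu⟩ := Sym2.mem_map.1 this
            exact ht u hu
          rcases h.cherry.eq_or_eq_or_eq ⟨map_mem_edgeSet hedge, hmem⟩ with h' | h' | h'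
          · exact key _ h.ne_keep h'
          · exact key _ h.ne_drop h'
          · exact he h'
        · rwa [h.map_leaf_of_ne hk] at hmem
  · intro e he h'
    obtain ⟨hne, h'⟩ := relabel_eq_none h'
    rcases h.cherry.eq_or_eq_or_eq he with rfl | rfl | rfl
    · simp [h0.leaf_edge h.cherry.adj_left] at h'
    · simp [h0.leaf_edge h.cherry.adj_right] at h'
    · exact hne rfl

end PrunesTo

end TrivalentTree

namespace TrivalentTree

variable {n : ℕ}

/-! ### Existence and uniqueness of the pruned tree. -/

section Prune

variable {A : TrivalentTree (n + 1)} {v w : A.V} {keep drop : Label (n + 1)}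

/-- The tree that is left when the two leaves of a cherry are removed. -/
theorem IsCherry.exists_prunesTo (hc : A.IsCherry v w keep drop) :
    ∃ (B : TrivalentTree n) (φ : B.G ↪g A.G), A.PrunesTo v w keep drop B φ := by
  classical
  let S : Set A.V := {u | u ≠ A.leaf keep ∧ u ≠ A.leaf drop}
  have hv : v ∈ S := ⟨hc.ne_leaf _, hc.ne_leaf _⟩
  have hw : w ∈ S := ⟨hc.third_ne_left, hc.third_ne_right⟩
  let G : SimpleGraph S := A.G.induce S
  have hconn : G.Connected := by
    -- This retraction folds the two removed leaves onto `v` and so carries paths of `A` to paths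
    -- that avoid them.
    let g : A.V → S := fun u => if hu : u ∈ S then ⟨u, hu⟩ else ⟨v, hv⟩
    have hg : ∀ u : S, g u = u := fun u => by simp [g]
    have hadj : ∀ x y, A.G.Adj x y → G.Reachable (g x) (g y) := by
      have key : ∀ x y, A.G.Adj x y → x ∉ S → g x = g y := by
        intro x y hxy hx
        have hy : y = v := by
          by_cases h1 : x = A.leaf keep
          · exact A.eq_of_adj_leaf (h1 ▸ hxy.symm) hc.adj_left
          · by_cases h2 : x = A.leaf drop
            · exact A.eq_of_adj_leaf (h2 ▸ hxy.symm) hc.adj_right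
            · exact absurd ⟨h1, h2⟩ hx
        subst hy
        simp [g, hx, hv]
      intro x y hxy
      by_cases hx : x ∈ S
      · by_cases hy : y ∈ S
        · refine SimpleGraph.Adj.reachable ?_
          simpa [G, g, hx, hy] using hxy
        · rw [key y x hxy.symm hy]
      · rw [key x y hxy hx]
    have hreach : ∀ x y, A.G.Reachable x y → G.Reachable (g x) (g y) := by
      rintro x y ⟨p⟩
      induction p with
      | nil => rfl
      | cons h _ ih => exact (hadj _ _ h).trans ih
    have : Nonempty S := ⟨⟨v, hv⟩⟩
    refine ⟨fun x y => ?_⟩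
    rw [← hg x, ← hg y]
    exact hreach _ _ (A.isTree.connected.preconnected _ _)
  have hNv : ∀ u : S, u.1 = v → (G.neighborSet u).ncard = 1 := by
    rintro ⟨_, _⟩ rfl
    rw [Set.ncard_eq_one]
    refine ⟨⟨w, hw⟩, Set.ext fun t => ?_⟩
    simp only [SimpleGraph.mem_neighborSet, Set.mem_singleton_iff]
    constructor
    · intro ht
      rcases hc.eq_of_adj t.1 ht with h | h | h
      · exact absurd h t.2.1
      · exact absurd h t.2.2
      · exact Subtype.ext h
    · rintro rfl
      exact hc.adj_third
  have hN : ∀ u : S, u.1 ≠ v → (G.neighborSet u).ncard = (A.G.neighborSet u.1).ncard := by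
    intro u hu
    rw [← Set.ncard_image_of_injective _ Subtype.val_injective]
    congr 1
    ext t
    simp only [Set.mem_image, SimpleGraph.mem_neighborSet, Subtype.exists, exists_and_right,
      exists_eq_right]
    constructor
    · rintro ⟨ht, h⟩
      exact h
    · intro h
      refine ⟨⟨?_, ?_⟩, h⟩
      · rintro rfl
        exact hu (A.eq_of_adj_leaf h hc.adj_left)
      · rintro rfl
        exact hu (A.eq_of_adj_leaf h hc.adj_right)
  let lf : Label n → S := fun y =>
    if h : drop.succAbove y = keep then ⟨v, hv⟩ else ⟨A.leaf (drop.succAbove y),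
      A.leaf_ne_leaf h, A.leaf_ne_leaf (Fin.succAbove_ne _ _)⟩
  have hlf : ∀ y, (lf y).1 = if drop.succAbove y = keep then v else A.leaf (drop.succAbove y) := by
    intro y
    by_cases h : drop.succAbove y = keep <;> simp [lf, h]
  refine ⟨{
    V := S
    finite := have := A.finite; inferInstance
    G := G
    isTree := ⟨hconn, A.isTree.isAcyclic.induce S⟩
    degree := fun u => by
      by_cases hu : u.1 = v
      · exact Or.inl (hNv u hu)
      · rw [hN u hu]
        exact A.degree u
    leaf := lf
    leaf_injective := fun y z hyz => by
      have := congrArg Subtype.val hyz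
      rw [hlf, hlf] at this
      split_ifs at this with h1 h2 h2
      · exact Fin.succAbove_right_injective (h1.trans h2.symm)
      · exact absurd this (hc.ne_leaf _)
      · exact absurd this.symm (hc.ne_leaf _)
      · exact Fin.succAbove_right_injective (A.leaf_injective this)
    leaf_range := fun u => by
      by_cases hu : u.1 = v
      · obtain ⟨y, hy⟩ := Fin.exists_succAbove_eq hc.ne
        simp only [hNv u hu, iff_true]
        exact ⟨y, Subtype.ext (by rw [hlf, if_pos hy, hu])⟩
      · rw [hN u hu, ← A.leaf_range]
        constructor
        · rintro ⟨y, rfl⟩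
          rw [hlf] at hu ⊢
          split_ifs at hu ⊢ with h
          · exact absurd rfl hu
          · exact ⟨_, rfl⟩
        · rintro ⟨x, hx⟩
          have hxk : x ≠ keep := by
            rintro rfl
            exact u.2.1 hx.symm
          have hxd : x ≠ drop := by
            rintro rfl
            exact u.2.2 hx.symm
          obtain ⟨y, rfl⟩ := Fin.exists_succAbove_eq hxd
          exact ⟨y, Subtype.ext (by rw [hlf, if_neg hxk, hx])⟩ },
    SimpleGraph.Embedding.induce S, hc, Subtype.range_coe, hlf⟩

/-- Both trees embed with the same image and the same labels. This makes `π_lazy` single-valued. -/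
theorem PrunesTo.equiv {B B' : TrivalentTree n} {φ : B.G ↪g A.G} {φ' : B'.G ↪g A.G}
    (h : A.PrunesTo v w keep drop B φ) (h' : A.PrunesTo v w keep drop B' φ') : B ≈ B' := by
  have h1 : ∀ u, ∃ u', φ' u' = φ u := fun u => h'.exists_eq (h.ne_keep u) (h.ne_drop u)
  have h2 : ∀ u', ∃ u, φ u = φ' u' := fun u => h.exists_eq (h'.ne_keep u) (h'.ne_drop u)
  choose f hf using h1
  choose g hg using h2
  refine ⟨⟨⟨f, g, fun u => φ.injective (by rw [hg, hf]), fun u => φ'.injective (by rw [hf, hg])⟩,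
    fun {a b} => ?_⟩, fun x => φ'.injective ?_⟩
  · change B'.G.Adj (f a) (f b) ↔ _
    rw [← φ'.map_adj_iff, hf, hf, φ.map_adj_iff]
  · change φ' (f _) = _
    rw [hf, h.map_leaf, h'.map_leaf]

theorem PrunesTo.trans_equiv {B B' : TrivalentTree n} {φ : B.G ↪g A.G}
    (h : A.PrunesTo v w keep drop B φ) (hB : B ≈ B') :
    ∃ φ', A.PrunesTo v w keep drop B' φ' := by
  obtain ⟨ψ, hψ⟩ := hB
  refine ⟨ψ.symm.toRelEmbedding.trans φ, h.cherry, ?_, fun y => ?_⟩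
  · rw [← h.range_eq]
    exact ψ.symm.surjective.range_comp φ
  · rw [← h.map_leaf, ← hψ]
    exact congrArg φ (ψ.symm_apply_apply _)

theorem IsCherry.map {A' : TrivalentTree n} {A : TrivalentTree n} {v w : A.V} {i j : Label n}
    (hc : A.IsCherry v w i j) (ψ : A.G ≃g A'.G) (hψ : ∀ x, ψ (A.leaf x) = A'.leaf x) :
    A'.IsCherry (ψ v) (ψ w) i j where
  ne := hc.ne
  adj_left := by rw [← hψ]; exact ψ.map_adj_iff.2 hc.adj_left
  adj_right := by rw [← hψ]; exact ψ.map_adj_iff.2 hc.adj_right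
  adj_third := ψ.map_adj_iff.2 hc.adj_third
  third_ne_left := by rw [← hψ]; exact fun h => hc.third_ne_left (ψ.injective h)
  third_ne_right := by rw [← hψ]; exact fun h => hc.third_ne_right (ψ.injective h)
  eq_of_adj := fun t ht => by
    obtain ⟨t, rfl⟩ := ψ.surjective t
    rw [← hψ, ← hψ, ψ.injective.eq_iff, ψ.injective.eq_iff, ψ.injective.eq_iff]
    exact hc.eq_of_adj t (ψ.map_adj_iff.1 ht)

theorem PrunesTo.map {A' : TrivalentTree (n + 1)} {B : TrivalentTree n} {φ : B.G ↪g A.G}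
    (h : A.PrunesTo v w keep drop B φ) (ψ : A.G ≃g A'.G) (hψ : ∀ x, ψ (A.leaf x) = A'.leaf x) :
    ∃ φ', A'.PrunesTo (ψ v) (ψ w) keep drop B φ' := by
  refine ⟨φ.trans ψ.toRelEmbedding, h.cherry.map ψ hψ, ?_, fun y => ?_⟩
  · ext u
    obtain ⟨u, rfl⟩ := ψ.surjective u
    rw [Set.mem_ofPred_eq, ← hψ, ← hψ, ψ.injective.ne_iff, ψ.injective.ne_iff]
    have : u ∈ Set.range φ ↔ u ∈ {w | w ≠ A.leaf keep ∧ w ≠ A.leaf drop} := by rw [h.range_eq]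
    refine Iff.trans ⟨?_, ?_⟩ this
    · rintro ⟨t, ht⟩
      exact ⟨t, ψ.injective ht⟩
    · rintro ⟨t, ht⟩
      exact ⟨t, congrArg ψ ht⟩
  · change ψ (φ _) = _
    rw [h.map_leaf]
    split_ifs
    · rfl
    · exact hψ _

end Prune

/-! ### Grafting a cherry, the inverse of pruning. -/

section Graft

/-- The graph `G` with two new vertices, both adjacent to `l` only. -/
def graftGraph {V : Type} (G : SimpleGraph V) (l : V) : SimpleGraph (V ⊕ Bool) where
  Adj
    | .inl x, .inl y => G.Adj x y
    | .inl x, .inr _ => x = l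
    | .inr _, .inl y => y = l
    | .inr _, .inr _ => False
  symm := ⟨by
    rintro (x | x) (y | y) h
    · exact SimpleGraph.Adj.symm h
    · exact h
    · exact h
    · exact h⟩
  loopless := ⟨by
    rintro (x | x) h
    · exact SimpleGraph.irrefl _ h
    · exact h⟩

variable {V : Type} {G : SimpleGraph V} {l : V}

/-- Connectedness is inherited, so counting suffices: two vertices are added, and the surjection `f`
shows that at most two edges are. -/
theorem graftGraph_isTree [Finite V] (hG : G.IsTree) (l : V) : (graftGraph G l).IsTree := by
  rw [SimpleGraph.isTree_iff_connected_and_card] at hG ⊢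
  have hinl : ∀ x y, G.Reachable x y → (graftGraph G l).Reachable (.inl x) (.inl y) := by
    rintro x y ⟨p⟩
    induction p with
    | nil => rfl
    | cons h _ ih => exact (SimpleGraph.Adj.reachable (by exact h)).trans ih
  have hl : ∀ x, (graftGraph G l).Reachable x (.inl l) := by
    rintro (x | b)
    · exact hinl _ _ (hG.1.preconnected _ _)
    · exact SimpleGraph.Adj.reachable (by exact rfl)
  have hconn : (graftGraph G l).Connected := by
    have : Nonempty (V ⊕ Bool) := ⟨.inl l⟩
    exact ⟨fun x y => (hl x).trans (hl y).symm⟩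
  refine ⟨hconn, le_antisymm ?_ hconn.card_vert_le_card_edgeSet_add_one⟩
  let f : G.edgeSet ⊕ Bool → (graftGraph G l).edgeSet := Sum.elim
    (fun e => ⟨e.1.map Sum.inl, by
      obtain ⟨e, he⟩ := e
      induction e with
      | _ x y => exact he⟩)
    (fun b => ⟨s(.inl l, .inr b), rfl⟩)
  have hf : Function.Surjective f := by
    rintro ⟨e, he⟩
    induction e with
    | _ x y =>
      rcases x with x | x <;> rcases y with y | y
      · exact ⟨.inl ⟨s(x, y), he⟩, rfl⟩
      · obtain rfl : x = l := he
        exact ⟨.inr y, rfl⟩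
      · obtain rfl : y = l := he
        exact ⟨.inr x, Subtype.ext Sym2.eq_swap⟩
      · exact he.elim
  have := Nat.card_le_card_of_surjective f hf
  rw [Nat.card_sum, Nat.card_eq_fintype_card (α := Bool), Fintype.card_bool] at this
  rw [Nat.card_sum, Nat.card_eq_fintype_card (α := Bool), Fintype.card_bool, ← hG.2]
  omega

/-- The leaf of `B` whose label corresponds to `keep` becomes the inner vertex `v`, with the new
leaves `keep` and `drop` attached to it. -/
theorem exists_prunesTo (B : TrivalentTree n) {keep drop : Label (n + 1)} (hne : keep ≠ drop) :
    ∃ (A : TrivalentTree (n + 1)) (v w : A.V) (φ : B.G ↪g A.G),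
      A.PrunesTo v w keep drop B φ := by
  classical
  obtain ⟨y, hy⟩ := Fin.exists_succAbove_eq hne
  have := B.finite
  let G := graftGraph B.G (B.leaf y)
  let lf : Label (n + 1) → B.V ⊕ Bool := drop.insertNth (α := fun _ => B.V ⊕ Bool) (.inr false)
    (fun z => if z = y then .inr true else .inl (B.leaf z))
  have hld : lf drop = .inr false := by simp [lf]
  have hlk : lf keep = .inr true := by rw [← hy]; simp [lf]
  have hlz : ∀ z, z ≠ y → lf (drop.succAbove z) = .inl (B.leaf z) := fun z hz => by
    simp [lf, hz]
  have hcases : ∀ x, x = drop ∨ x = keep ∨ ∃ z, z ≠ y ∧ x = drop.succAbove z := by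
    intro x
    by_cases hx : x = drop
    · exact Or.inl hx
    · obtain ⟨z, rfl⟩ := Fin.exists_succAbove_eq hx
      by_cases hz : z = y
      · exact Or.inr (Or.inl (by rw [hz, hy]))
      · exact Or.inr (Or.inr ⟨z, hz, rfl⟩)
  have hNr : ∀ b, (G.neighborSet (.inr b)).ncard = 1 := by
    intro b
    rw [Set.ncard_eq_one]
    refine ⟨.inl (B.leaf y), Set.ext fun t => ?_⟩
    rcases t with t | t
    · simp only [SimpleGraph.mem_neighborSet, Set.mem_singleton_iff, Sum.inl.injEq]
      exact Iff.rfl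
    · simp only [SimpleGraph.mem_neighborSet, Set.mem_singleton_iff, reduceCtorEq, iff_false]
      exact id
  obtain ⟨w, hw⟩ := B.exists_adj_leaf y
  have hNv : (G.neighborSet (.inl (B.leaf y))).ncard = 3 := by
    rw [Set.ncard_eq_three]
    refine ⟨.inr true, .inr false, .inl w, by simp, by simp, by simp, Set.ext fun t => ?_⟩
    rcases t with t | t
    · simp only [SimpleGraph.mem_neighborSet, Set.mem_insert_iff, Set.mem_singleton_iff,
        Sum.inl.injEq, reduceCtorEq, false_or]
      exact ⟨fun h => B.eq_of_adj_leaf (SimpleGraph.Adj.symm h) hw,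
        fun h => h ▸ SimpleGraph.Adj.symm hw⟩
    · cases t <;> simp [G, graftGraph]
  have hNl : ∀ u, u ≠ B.leaf y →
      (G.neighborSet (.inl u)).ncard = (B.G.neighborSet u).ncard := by
    intro u hu
    rw [← Set.ncard_image_of_injective (B.G.neighborSet u) (Sum.inl_injective (β := Bool))]
    congr 1
    ext t
    rcases t with t | t <;> simp [G, graftGraph, hu]
  refine ⟨{
    V := B.V ⊕ Bool
    finite := inferInstance
    G := G
    isTree := graftGraph_isTree B.isTree _
    degree := by
      rintro (u | b)
      · by_cases hu : u = B.leaf y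
        · exact Or.inr (hu ▸ hNv)
        · rw [hNl u hu]
          exact B.degree u
      · exact Or.inl (hNr b)
    leaf := lf
    leaf_injective := by
      intro a b hab
      rcases hcases a with rfl | rfl | ⟨a, ha, rfl⟩ <;>
        rcases hcases b with rfl | rfl | ⟨b, hb, rfl⟩ <;>
        first
        | rfl
        | (simp [*] at hab; done)
        | skip
      rw [hlz a ha, hlz b hb, Sum.inl.injEq] at hab
      rw [B.leaf_injective hab]
    leaf_range := by
      rintro (u | b)
      · by_cases hu : u = B.leaf y
        · subst hu
          simp only [hNv, OfNat.ofNat_ne_one, iff_false]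
          rintro ⟨x, hx⟩
          rcases hcases x with rfl | rfl | ⟨z, hz, rfl⟩
          · simp [hld] at hx
          · simp [hlk] at hx
          · rw [hlz z hz, Sum.inl.injEq] at hx
            exact hz (B.leaf_injective hx)
        · rw [hNl u hu, ← B.leaf_range]
          constructor
          · rintro ⟨x, hx⟩
            rcases hcases x with rfl | rfl | ⟨z, hz, rfl⟩
            · simp [hld] at hx
            · simp [hlk] at hx
            · rw [hlz z hz, Sum.inl.injEq] at hx
              exact ⟨z, hx⟩
          · rintro ⟨z, rfl⟩
            exact ⟨_, hlz z fun h => hu (h ▸ rfl)⟩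
      · simp only [hNr, iff_true]
        cases b
        · exact ⟨_, hld⟩
        · exact ⟨_, hlk⟩ }, .inl (B.leaf y), .inl w, ⟨Function.Embedding.inl, Iff.rfl⟩, ?_, ?_, ?_⟩
  · refine ⟨hne, ?_, ?_, SimpleGraph.Adj.symm hw, ?_, ?_, ?_⟩
    · change G.Adj _ (lf keep)
      rw [hlk]
      rfl
    · change G.Adj _ (lf drop)
      rw [hld]
      rfl
    · change _ ≠ lf keep
      simp [hlk]
    · change _ ≠ lf drop
      simp [hld]
    · intro t ht
      change t = lf keep ∨ t = lf drop ∨ _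
      rw [hlk, hld]
      rcases t with t | t
      · exact Or.inr (Or.inr (congrArg Sum.inl (B.eq_of_adj_leaf (SimpleGraph.Adj.symm ht) hw)))
      · cases t <;> simp
  · change Set.range Sum.inl = {w | w ≠ lf keep ∧ w ≠ lf drop}
    rw [hlk, hld]
    ext t
    rcases t with t | t
    · simp
    · cases t <;> simp
  · intro z
    change Sum.inl (B.leaf z) = if _ then _ else lf _
    rw [← hy]
    by_cases hz : z = y
    · simp [hz]
    · rw [if_neg fun h => hz (Fin.succAbove_right_injective h), hlz z hz]

/-- Pruning loses nothing: any `A` that prunes to `B` is the graft of `B`. Thus `keep`, `drop` and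
the class of `B` determine the class of `A`. -/
theorem PrunesTo.exists_iso {A : TrivalentTree (n + 1)} {v w : A.V} {keep drop : Label (n + 1)}
    {B : TrivalentTree n} {φ : B.G ↪g A.G} (h : A.PrunesTo v w keep drop B φ) {y : Label n}
    (hy : drop.succAbove y = keep) :
    ∃ e : graftGraph B.G (B.leaf y) ≃g A.G, (∀ u, e (.inl u) = φ u) ∧
      e (.inr true) = A.leaf keep ∧ e (.inr false) = A.leaf drop := by
  let f : B.V ⊕ Bool → A.V := Sum.elim φ fun b => if b then A.leaf keep else A.leaf drop
  have hne := A.leaf_ne_leaf h.cherry.ne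
  have hf : Function.Bijective f := by
    constructor
    · rintro (a | (_ | _)) (b | (_ | _)) hab <;>
        simp [f, h.ne_keep, h.ne_drop, hne, hne.symm, (h.ne_keep _).symm, (h.ne_drop _).symm]
          at hab ⊢
      exact hab
    · intro u
      by_cases h1 : u = A.leaf keep
      · exact ⟨.inr true, h1.symm⟩
      by_cases h2 : u = A.leaf drop
      · exact ⟨.inr false, h2.symm⟩
      obtain ⟨u', rfl⟩ := h.exists_eq h1 h2
      exact ⟨.inl u', rfl⟩
  have hv : φ (B.leaf y) = v := by rw [h.map_leaf, if_pos hy]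
  have hadj : ∀ (u : B.V) (b : Bool),
      A.G.Adj (φ u) (if b then A.leaf keep else A.leaf drop) ↔ u = B.leaf y := by
    intro u b
    rw [← φ.injective.eq_iff, hv]
    cases b
    · exact ⟨fun h' => A.eq_of_adj_leaf h' h.cherry.adj_right,
        fun h' => h' ▸ h.cherry.adj_right⟩
    · exact ⟨fun h' => A.eq_of_adj_leaf h' h.cherry.adj_left,
        fun h' => h' ▸ h.cherry.adj_left⟩
  refine ⟨⟨Equiv.ofBijective f hf, fun {a b} => ?_⟩, fun _ => rfl, rfl, rfl⟩
  change A.G.Adj (f a) (f b) ↔ _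
  rcases a with a | a <;> rcases b with b | b
  · exact φ.map_adj_iff
  · exact hadj a b
  · exact (SimpleGraph.adj_comm _ _ _).trans (hadj b a)
  · refine iff_of_false ?_ id
    cases a <;> cases b <;> exact A.not_adj_leaf_leaf _ _

theorem PrunesTo.equiv_of_equiv {A A' : TrivalentTree (n + 1)} {v w : A.V} {v' w' : A'.V}
    {keep drop : Label (n + 1)} {B B' : TrivalentTree n} {φ : B.G ↪g A.G} {φ' : B'.G ↪g A'.G}
    (h : A.PrunesTo v w keep drop B φ) (h' : A'.PrunesTo v' w' keep drop B' φ') (hB : B ≈ B') :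
    A ≈ A' := by
  obtain ⟨φ, h⟩ := h.trans_equiv hB
  obtain ⟨y, hy⟩ := Fin.exists_succAbove_eq h.cherry.ne
  obtain ⟨e, he, hek, hed⟩ := h.exists_iso hy
  obtain ⟨e', he', hek', hed'⟩ := h'.exists_iso hy
  refine ⟨e.symm.trans e', fun x => ?_⟩
  change e' (e.symm _) = _
  by_cases hxd : x = drop
  · rw [hxd, ← hed, e.symm_apply_apply, hed']
  by_cases hxk : x = keep
  · rw [hxk, ← hek, e.symm_apply_apply, hek']
  obtain ⟨z, rfl⟩ := Fin.exists_succAbove_eq hxd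
  rw [← h.map_leaf_of_ne hxk, ← h'.map_leaf_of_ne hxk, ← he, e.symm_apply_apply, he']

end Graft

end TrivalentTree

namespace TrivalentTree

variable {n : ℕ}

/-! ### The first round. -/

section First

/-- The leaves `i < j` of the cherry at `v` are the first pair to face off; `w` is the third
neighbour of `v`. -/
structure IsFirst (T : TrivalentTree (n + 1)) (i j : Label (n + 1)) (v w : T.V) : Prop where
  lt : i < j
  cherry : T.IsCherry v w i j
  le : ∀ v' w' i' j', i' < j' → T.IsCherry v' w' i' j' → i' ≤ i

variable {T : TrivalentTree (n + 1)} {i j : Label (n + 1)} {v w : T.V}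

theorem exists_isFirst (T : TrivalentTree (n + 1)) (hT : T.ABShareVertex) :
    ∃ i j v w, T.IsFirst i j v w ∧ 2 ≤ i.val := by
  obtain ⟨v₀, w₀, i₀, j₀, h2, hlt, hc⟩ := T.exists_isCherry_ge_two hT
  obtain ⟨i, ⟨v, w, j, hij, hc'⟩, hmax⟩ := Set.exists_max_image
    {i | ∃ v w j, i < j ∧ T.IsCherry v w i j} id (Set.toFinite _) ⟨i₀, v₀, w₀, j₀, hlt, hc⟩
  refine ⟨i, j, v, w, ⟨hij, hc', fun v' w' i' j' h h' => hmax i' ⟨v', w', j', h, h'⟩⟩, ?_⟩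
  exact h2.trans (hmax i₀ ⟨v₀, w₀, j₀, hlt, hc⟩)

theorem IsFirst.two_le (h : T.IsFirst i j v w) (hT : T.ABShareVertex) : 2 ≤ i.val := by
  obtain ⟨v₀, w₀, i₀, j₀, h2, hlt, hc⟩ := T.exists_isCherry_ge_two hT
  exact h2.trans (h.le _ _ _ _ hlt hc)

/-- Maximality fixes `i`; the leaf `i` fixes its neighbour `v`, and `v` fixes the rest. -/
theorem IsFirst.unique (h : T.IsFirst i j v w) {i' j' : Label (n + 1)} {v' w' : T.V}
    (h' : T.IsFirst i' j' v' w') : i' = i ∧ j' = j ∧ v' = v ∧ w' = w := by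
  obtain rfl : i' = i := le_antisymm (h.le _ _ _ _ h'.lt h'.cherry) (h'.le _ _ _ _ h.lt h.cherry)
  obtain rfl : v' = v := T.eq_of_adj_leaf h'.cherry.adj_left h.cherry.adj_left
  have hj : j' = j := by
    rcases h.cherry.eq_of_adj _ h'.cherry.adj_right with h1 | h1 | h1
    · exact absurd (T.leaf_injective h1) h'.lt.ne'
    · exact T.leaf_injective h1
    · exact absurd h1.symm (h.cherry.third_ne_leaf _)
  subst hj
  refine ⟨rfl, rfl, rfl, ?_⟩
  rcases h.cherry.eq_of_adj _ h'.cherry.adj_third with h1 | h1 | h1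
  · exact absurd h1 (h'.cherry.third_ne_leaf _)
  · exact absurd h1 (h'.cherry.third_ne_leaf _)
  · exact h1

theorem IsInitial.facesOff_iff {lab : T.EdgeLabeling} (h0 : T.IsInitial lab) {E : Sym2 T.V} :
    T.FacesOff lab i j E ↔ ∃ v w, T.IsFirst i j v w ∧ E = s(v, w) := by
  unfold FacesOff
  simp only [h0.canFaceOff_iff]
  constructor
  · rintro ⟨⟨hij, v, w, hc, rfl⟩, hmax⟩
    exact ⟨v, w, ⟨hij, hc, fun v' w' i' j' h h' => hmax i' j' _ ⟨h, v', w', h', rfl⟩⟩, rfl⟩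
  · rintro ⟨v, w, h, rfl⟩
    refine ⟨⟨h.lt, v, w, h.cherry, rfl⟩, ?_⟩
    rintro i' j' _ ⟨h1, v', w', h', rfl⟩
    exact h.le _ _ _ _ h1 h'

theorem firstFaceOff_iff : T.FirstFaceOff i j v ↔ ∃ w, T.IsFirst i j v w := by
  constructor
  · rintro ⟨⟨lab, h0, E, hE⟩, hi, hj⟩
    obtain ⟨v', w, h, rfl⟩ := h0.facesOff_iff.1 hE
    obtain rfl : v' = v := T.eq_of_adj_leaf h.cherry.adj_left hi
    exact ⟨w, h⟩
  · rintro ⟨w, h⟩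
    obtain ⟨lab, h0⟩ := T.exists_isInitial
    exact ⟨⟨lab, h0, _, h0.facesOff_iff.2 ⟨v, w, h, rfl⟩⟩, h.cherry.adj_left, h.cherry.adj_right⟩

/-- The loser `i` of a first round between `i` and `j` advances: there is a larger leaf other than
`j` next to the edge reached. -/
def LoserAdvances (T : TrivalentTree (n + 1)) (w : T.V) (i j : Label (n + 1)) : Prop :=
  ∃ u, T.G.Adj w (T.leaf u) ∧ u ≠ j ∧ i < u

/-- In the first round between `i` and `j` the label `keep` advances, and `drop` does not. -/
def FirstAdvances (T : TrivalentTree (n + 1)) (w : T.V) (i j keep drop : Label (n + 1)) : Prop :=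
  T.LoserAdvances w i j ∧ keep = i ∧ drop = j ∨ ¬ T.LoserAdvances w i j ∧ keep = j ∧ drop = i

variable {keep drop : Label (n + 1)}

theorem exists_firstAdvances (T : TrivalentTree (n + 1)) (w : T.V) (i j : Label (n + 1)) :
    ∃ keep drop, T.FirstAdvances w i j keep drop := by
  by_cases h : T.LoserAdvances w i j
  · exact ⟨i, j, Or.inl ⟨h, rfl, rfl⟩⟩
  · exact ⟨j, i, Or.inr ⟨h, rfl, rfl⟩⟩

theorem FirstAdvances.isCherry (h : T.FirstAdvances w i j keep drop) (hc : T.IsCherry v w i j) :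
    T.IsCherry v w keep drop := by
  rcases h with ⟨-, rfl, rfl⟩ | ⟨-, rfl, rfl⟩
  · exact hc
  · exact hc.symm

theorem FirstAdvances.advance_eq (h : T.FirstAdvances w i j keep drop) (hc : T.IsCherry v w i j)
    {lab : T.EdgeLabeling} (h0 : T.IsInitial lab) :
    T.advance lab i j s(v, w) = T.relabel lab s(v, w) keep := by
  rcases h with ⟨h, rfl, rfl⟩ | ⟨h, rfl, rfl⟩
  · exact advance_of_laziness ((h0.lazinessApplies_iff hc).2 h)
  · exact advance_of_not_laziness (mt (h0.lazinessApplies_iff hc).1 h)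

variable {rs : List (Label (n + 1) × Label (n + 1))}

theorem IsFirst.isTournament_iff (h : T.IsFirst i j v w) :
    T.IsTournament rs ↔ ∃ rs', rs = (i, j) :: rs' ∧
      ∀ lab, T.IsInitial lab → T.Run (T.advance lab i j s(v, w)) rs' := by
  constructor
  · rintro ⟨lab, h0, hrun⟩
    cases hrun with
    | done _ h1 =>
      exact absurd (h0.eq_none h.cherry.ne_leaf h.cherry.third_ne_leaf) (h1 _ h.cherry.adj_third)
    | round _ x y E rs hf hrun =>
      obtain ⟨v', w', h', rfl⟩ := h0.facesOff_iff.1 hf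
      obtain ⟨rfl, rfl, rfl, rfl⟩ := h.unique h'
      exact ⟨rs, rfl, fun lab' h0' => h0.unique h0' ▸ hrun⟩
  · rintro ⟨rs', rfl, hrun⟩
    obtain ⟨lab, h0⟩ := T.exists_isInitial
    exact ⟨lab, h0, Run.round _ _ _ _ _ (h0.facesOff_iff.2 ⟨v, w, h, rfl⟩) (hrun lab h0)⟩

/-- The tournament of a tree is, after its first round, that of the pruned tree. -/
theorem IsFirst.isTournament_iff_of_prunesTo (h : T.IsFirst i j v w) {B : TrivalentTree n}
    {φ : B.G ↪g T.G} (hp : T.PrunesTo v w keep drop B φ)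
    (hadv : T.FirstAdvances w i j keep drop) :
    T.IsTournament rs ↔
      ∃ rs', rs = (i, j) :: rs'.map (Prod.map drop.succAbove drop.succAbove) ∧
        B.IsTournament rs' := by
  rw [h.isTournament_iff]
  obtain ⟨lab', h0'⟩ := B.exists_isInitial
  constructor
  · rintro ⟨rs, rfl, hrun⟩
    obtain ⟨lab, h0⟩ := T.exists_isInitial
    have := hrun lab h0
    rw [hadv.advance_eq h.cherry h0] at this
    obtain ⟨rs', rfl, hrun'⟩ := (hp.restricts h0 h0').exists_run this
    exact ⟨rs', rfl, lab', h0', hrun'⟩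
  · rintro ⟨rs', rfl, lab'', h0'', hrun⟩
    refine ⟨_, rfl, fun lab h0 => ?_⟩
    rw [hadv.advance_eq h.cherry h0]
    exact (hp.restricts h0 h0'').run hrun

/-- If the winner `j` of the first round advances but does not win again, the tournament goes on
as if the loser had advanced. -/
theorem IsFirst.exists_isTournament_of_not_loserAdvances (h : T.IsFirst i j v w)
    {B : TrivalentTree n} {φ : B.G ↪g T.G} (hp : T.PrunesTo v w i j B φ)
    (hadv : ¬ T.LoserAdvances w i j) (hT : T.IsTournament ((i, j) :: rs))
    (hrs : ∀ p ∈ rs, p.2 ≠ j) :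
    ∃ rs', rs = rs'.map (Prod.map j.succAbove j.succAbove) ∧ B.IsTournament rs' := by
  obtain ⟨_, he, hrun⟩ := h.isTournament_iff.1 hT
  obtain rfl := (List.cons.inj he).2
  obtain ⟨lab, h0⟩ := T.exists_isInitial
  obtain ⟨lab', h0'⟩ := B.exists_isInitial
  have hadv' := advance_of_not_laziness (mt (h0.lazinessApplies_iff h.cherry).1 hadv)
  have hrun := hrun lab h0
  -- Apart from `s(v, w)`, only the two leaf edges at `v` carry `i` or `j`, and all three edges at
  -- `v` are now labelled.
  have hdead : ∀ g ∈ T.G.edgeSet, g ≠ s(v, w) →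
      T.relabel lab s(v, w) j g = some i ∨ T.relabel lab s(v, w) j g = some j →
      ∀ F ∈ T.G.edgeSet, (∃ v, v ∈ g ∧ v ∈ F) → T.relabel lab s(v, w) j F ≠ none := by
    intro g hg hgE hl F hF ⟨p, hpg, hpF⟩ hF0
    obtain ⟨hFE, hF0⟩ := relabel_eq_none hF0
    rw [relabel_of_ne hgE] at hl
    have hv : ∀ x, x = i ∨ x = j → T.G.Adj v (T.leaf x) := by
      rintro x (rfl | rfl)
      · exact h.cherry.adj_left
      · exact h.cherry.adj_right
    obtain ⟨x, hx, hgx⟩ : ∃ x, (x = i ∨ x = j) ∧ lab g = some x := by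
      rcases hl with hl | hl
      · exact ⟨i, Or.inl rfl, hl⟩
      · exact ⟨j, Or.inr rfl, hl⟩
    have hgv : g = s(v, T.leaf x) := by
      obtain ⟨hg1, t, rfl⟩ := (h0 _ _).1 hgx
      have ht : t = v := T.eq_of_adj_leaf (SimpleGraph.Adj.symm hg1) (hv x hx)
      rw [ht, Sym2.eq_swap]
    have hFv : F ∈ T.G.incidenceSet v := by
      refine ⟨hF, ?_⟩
      rw [hgv] at hpg
      rcases Sym2.mem_iff.1 hpg with rfl | rfl
      · exact hpF
      · obtain ⟨t, rfl⟩ := hpF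
        have ht : t = v := T.eq_of_adj_leaf (SimpleGraph.Adj.symm hF) (hv x hx)
        simp [ht]
    rcases h.cherry.eq_or_eq_or_eq hFv with rfl | rfl | rfl
    · simp [h0.leaf_edge h.cherry.adj_left] at hF0
    · simp [h0.leaf_edge h.cherry.adj_right] at hF0
    · exact hFE rfl
  -- Monotonicity of losers gives `x ≤ i`; equality would need an edge labelled `i` that can still
  -- play.
  have hlt : ∀ x y F, T.CanFaceOff (T.relabel lab s(v, w) j) x y F → x < i := by
    intro x y F hc
    have hle := (h0.facesOff_iff.2 ⟨v, w, h, rfl⟩).le_of_canFaceOff_advance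
      (by rw [hadv']; exact hc)
    refine lt_of_le_of_ne hle ?_
    rintro rfl
    obtain ⟨hF, hF0, ⟨g, hg, hgx, hv⟩, -⟩ := hc.exists_adjacent
    refine hdead g hg ?_ (Or.inl hgx) F hF hv hF0
    rintro rfl
    rw [relabel_self] at hgx
    exact h.lt.ne' (Option.some.inj hgx)
  rw [hadv'] at hrun
  have hrun := hrun.relabel h.lt relabel_self hdead hlt hrs
  have : T.relabel (T.relabel lab s(v, w) j) s(v, w) i = T.relabel lab s(v, w) i := by
    funext e
    by_cases he : e = s(v, w)
    · rw [he, relabel_self, relabel_self]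
    · rw [relabel_of_ne he, relabel_of_ne he, relabel_of_ne he]
  rw [this] at hrun
  obtain ⟨rs', rfl, hrun'⟩ := (hp.restricts h0 h0').exists_run hrun
  exact ⟨rs', rfl, lab', h0', hrun'⟩

end First

/-! ### Leaves and cherries of the pruned tree. -/

section Prune

variable {A : TrivalentTree (n + 1)} {v w : A.V} {keep drop : Label (n + 1)}
  {B : TrivalentTree n} {φ : B.G ↪g A.G}

theorem le_succAbove (p : Label (n + 1)) (x : Label n) : x.val ≤ (p.succAbove x).val := by
  unfold Fin.succAbove
  split_ifs <;> simp

theorem succAbove_of_lt {p : Label (n + 1)} {x : Label n} (h : x.val < p.val) :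
    p.succAbove x = x.castSucc :=
  Fin.succAbove_of_castSucc_lt _ _ h

namespace PrunesTo

/-- The labels a and b lie below `keep` and `drop`, so pruning neither renames nor moves their
leaves. -/
theorem abShareVertex_iff (h : A.PrunesTo v w keep drop B φ) (hk : 2 ≤ keep.val)
    (hd : 2 ≤ drop.val) : B.ABShareVertex ↔ A.ABShareVertex := by
  have h0 : φ (B.leaf 0) = A.leaf 0 := by
    have : drop.succAbove 0 = 0 := succAbove_of_lt (by change 0 < _; omega)
    rw [h.map_leaf_of_ne, this]
    rw [this]
    rintro rfl
    simp at hk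
  have h1 : φ (B.leaf 1) = A.leaf 1 := by
    have : drop.succAbove 1 = 1 := by
      rw [succAbove_of_lt (by simp; omega)]
      ext
      simp
    rw [h.map_leaf_of_ne, this]
    rw [this]
    rintro rfl
    simp at hk
  constructor
  · rintro ⟨o, ha, hb⟩
    exact ⟨φ o, h0 ▸ φ.map_adj_iff.2 ha, h1 ▸ φ.map_adj_iff.2 hb⟩
  · rintro ⟨o, ha, hb⟩
    obtain ⟨o, rfl⟩ := h.exists_eq (A.ne_leaf_of_adj ha keep) (A.ne_leaf_of_adj ha drop)
    exact ⟨o, φ.map_adj_iff.1 (h0 ▸ ha), φ.map_adj_iff.1 (h1 ▸ hb)⟩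

/-- A leaf of `A` next to `w` forms a cherry of `B` with the leaf `keep`. -/
theorem adj_third_iff (h : A.PrunesTo v w keep drop B φ) {y u : Label n}
    (hy : drop.succAbove y = keep) (hu : u ≠ y) :
    A.G.Adj w (A.leaf (drop.succAbove u)) ↔ ∃ v' w', B.IsCherry v' w' y u := by
  have hu' : drop.succAbove u ≠ keep := fun h' =>
    hu (Fin.succAbove_right_injective (h'.trans hy.symm))
  have hv : φ (B.leaf y) = v := by rw [h.map_leaf, if_pos hy]
  rw [← h.map_leaf_of_ne hu']
  constructor
  · intro hadj
    obtain ⟨w, rfl⟩ := h.exists_eq h.cherry.third_ne_left h.cherry.third_ne_right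
    have h1 : B.G.Adj w (B.leaf y) := φ.map_adj_iff.1 (hv ▸ h.cherry.adj_third.symm)
    obtain ⟨w', hw'⟩ := B.exists_isCherry hu.symm h1 (φ.map_adj_iff.1 hadj)
    exact ⟨w, w', hw'⟩
  · rintro ⟨v', w', hc⟩
    have h1 : A.G.Adj v (φ v') := hv ▸ φ.map_adj_iff.2 hc.adj_left.symm
    have h2 : φ v' = w := by
      rcases h.cherry.eq_of_adj _ h1 with h' | h' | h'
      · exact absurd h' (h.ne_keep _)
      · exact absurd h' (h.ne_drop _)
      · exact h'
    rw [← h2]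
    exact φ.map_adj_iff.2 hc.adj_right

/-- The cherries of `A` are that of the leaves `keep` and `drop`, and cherries of `B`. -/
theorem isCherry_cases (h : A.PrunesTo v w keep drop B φ) {v' w' : A.V} {x y : Label (n + 1)}
    (hc : A.IsCherry v' w' x y) :
    x = keep ∧ y = drop ∨ x = drop ∧ y = keep ∨
      ∃ x' y', x = drop.succAbove x' ∧ y = drop.succAbove y' ∧
        ∃ v'' w'', B.IsCherry v'' w'' x' y' := by
  have key : v' = v → (x = keep ∨ x = drop) ∧ (y = keep ∨ y = drop) := by
    rintro rfl
    constructor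
    · rcases h.cherry.eq_of_adj _ hc.adj_left with h' | h' | h'
      · exact Or.inl (A.leaf_injective h')
      · exact Or.inr (A.leaf_injective h')
      · exact absurd h'.symm (h.cherry.third_ne_leaf _)
    · rcases h.cherry.eq_of_adj _ hc.adj_right with h' | h' | h'
      · exact Or.inl (A.leaf_injective h')
      · exact Or.inr (A.leaf_injective h')
      · exact absurd h'.symm (h.cherry.third_ne_leaf _)
  have hne := hc.ne
  by_cases hv : v' = v
  · obtain ⟨rfl | rfl, rfl | rfl⟩ := key hv
    · exact absurd rfl hne
    · exact Or.inl ⟨rfl, rfl⟩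
    · exact Or.inr (Or.inl ⟨rfl, rfl⟩)
    · exact absurd rfl hne
  · right; right
    have hother : ∀ z, A.G.Adj v' (A.leaf z) → z ≠ keep ∧ z ≠ drop := by
      intro z hz
      constructor
      · rintro rfl
        exact hv (A.eq_of_adj_leaf hz h.cherry.adj_left)
      · rintro rfl
        exact hv (A.eq_of_adj_leaf hz h.cherry.adj_right)
    obtain ⟨hxk, hxd⟩ := hother x hc.adj_left
    obtain ⟨hyk, hyd⟩ := hother y hc.adj_right
    obtain ⟨x, rfl⟩ := Fin.exists_succAbove_eq hxd
    obtain ⟨y, rfl⟩ := Fin.exists_succAbove_eq hyd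
    obtain ⟨v', rfl⟩ := h.exists_eq (hc.ne_leaf keep) (hc.ne_leaf drop)
    have h1 := hc.adj_left
    have h2 := hc.adj_right
    rw [← h.map_leaf_of_ne hxk] at h1
    rw [← h.map_leaf_of_ne hyk] at h2
    obtain ⟨w'', hw''⟩ := B.exists_isCherry (fun h' => hne (congrArg _ h')) (φ.map_adj_iff.1 h1)
      (φ.map_adj_iff.1 h2)
    exact ⟨x, y, rfl, rfl, v', w'', hw''⟩

end PrunesTo

end Prune

/-! ### Trees with three leaves. -/

section Small

variable {T : TrivalentTree 0} {o : T.V}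

/-- By the vertex count such a tree has four vertices, three of them leaves. -/
theorem eq_or_eq_leaf (ho : ∀ x, o ≠ T.leaf x) (v : T.V) : v = o ∨ ∃ x, v = T.leaf x := by
  classical
  have := T.finite
  have := Fintype.ofFinite T.V
  have hcard := T.card_vertices
  rw [Nat.card_eq_fintype_card] at hcard
  have : insert o (Finset.univ.image T.leaf) = Finset.univ := by
    apply Finset.eq_univ_of_card
    rw [Finset.card_insert_of_notMem, Finset.card_image_of_injective _ T.leaf_injective]
    · simp; omega
    · simp only [Finset.mem_image, Finset.mem_univ, true_and, not_exists]
      exact fun x hx => ho x hx.symm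
  have hv := this ▸ Finset.mem_univ v
  rw [Finset.mem_insert, Finset.mem_image] at hv
  rcases hv with hv | ⟨x, -, hx⟩
  · exact Or.inl hv
  · exact Or.inr ⟨x, hx.symm⟩

theorem adj_leaf_of_ne_leaf (ho : ∀ x, o ≠ T.leaf x) (x : Label 0) : T.G.Adj o (T.leaf x) := by
  obtain ⟨v, hv⟩ := T.exists_adj_leaf x
  rcases eq_or_eq_leaf ho v with rfl | ⟨y, rfl⟩
  · exact hv
  · exact absurd hv (T.not_adj_leaf_leaf _ _)

theorem isTournament_zero_iff (hT : T.ABShareVertex) {rs : List (Label 0 × Label 0)} :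
    T.IsTournament rs ↔ rs = [] := by
  obtain ⟨o, ha, -⟩ := hT
  have ho := T.ne_leaf_of_adj ha
  have key : ∀ lab, T.IsInitial lab → ∀ e ∈ T.G.edgeSet, lab e ≠ none := by
    intro lab h0 e he h'
    have hno : ∀ v ∈ e, v = o := by
      intro v hv
      refine (eq_or_eq_leaf ho v).resolve_right ?_
      rintro ⟨x, rfl⟩
      rw [(h0 e x).2 ⟨he, hv⟩] at h'
      simp at h'
    induction e with
    | _ p q =>
      have hp := hno p (by simp)
      have hq := hno q (by simp)
      subst hp hq
      exact SimpleGraph.irrefl _ he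
  constructor
  · rintro ⟨lab, h0, hrun⟩
    cases hrun with
    | done => rfl
    | round _ i j E rs hf hrun =>
      obtain ⟨hE, hE0, -⟩ := hf.1.exists_adjacent
      exact absurd hE0 (key lab h0 E hE)
  · rintro rfl
    obtain ⟨lab, h0⟩ := T.exists_isInitial
    exact ⟨lab, h0, Run.done _ (key lab h0)⟩

end Small

end TrivalentTree

/-! ### Uniqueness of the tournament and properties of its rounds. -/

namespace TrivalentTree

variable {n : ℕ}

theorem Run.fst_le {T : TrivalentTree n} {lab : T.EdgeLabeling} {p q : Label n × Label n}
    {rs : List (Label n × Label n)} (h : T.Run lab (p :: q :: rs)) : q.1 ≤ p.1 := by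
  cases h with
  | round _ i j E _ hf h =>
    cases h with
    | round _ i' j' E' _ hf' h => exact hf.le_of_canFaceOff_advance hf'.1

/-- The properties of the list of rounds of a tournament used to recover the first loser. -/
structure IsRoundList (rs : List (Label n × Label n)) : Prop where
  length_eq : rs.length = n
  three_le : ∀ p ∈ rs, 3 ≤ p.2.val
  head_ge : ∀ p ∈ rs.head?, 2 ≤ p.1.val
  head_ne : ∀ p ∈ rs.head?, ∀ q ∈ rs, q.2 ≠ p.1
  exists_win : ∀ x : Label n, 3 ≤ x.val → (∀ p ∈ rs.head?, p.1 < x) → ∃ q ∈ rs, q.2 = x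

/-- Induction by pruning the first cherry according to the laziness rule. That the first loser never
wins is where the rule matters. -/
theorem exists_tournament (T : TrivalentTree n) (hT : T.ABShareVertex) :
    ∃ rs, (∀ rs', T.IsTournament rs' ↔ rs' = rs) ∧ IsRoundList rs := by
  induction n with
  | zero =>
    refine ⟨[], fun rs' => isTournament_zero_iff hT, rfl, by simp, by simp, by simp, ?_⟩
    intro x hx
    omega
  | succ n ih =>
    obtain ⟨i, j, v, w, hf, hi⟩ := T.exists_isFirst hT
    obtain ⟨keep, drop, hadv⟩ := T.exists_firstAdvances w i j
    obtain ⟨B, φ, hp⟩ := (hadv.isCherry hf.cherry).exists_prunesTo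
    have hij : i.val < j.val := hf.lt
    have hkd : 2 ≤ keep.val ∧ 2 ≤ drop.val := by
      rcases hadv with ⟨-, rfl, rfl⟩ | ⟨-, rfl, rfl⟩ <;> omega
    obtain ⟨rs, hrs, hr⟩ := ih B ((hp.abShareVertex_iff hkd.1 hkd.2).2 hT)
    have hiff : ∀ rs', T.IsTournament rs' ↔
        rs' = (i, j) :: rs.map (Prod.map drop.succAbove drop.succAbove) := fun rs' => by
      rw [hf.isTournament_iff_of_prunesTo hp hadv]
      constructor
      · rintro ⟨rs'', h1, h2⟩
        rw [h1, (hrs _).1 h2]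
      · intro h
        exact ⟨rs, h, (hrs _).2 rfl⟩
    -- Losers weakly decrease, applied to the first two rounds of `T`.
    have hle : ∀ p ∈ rs.head?, drop.succAbove p.1 ≤ i := by
      intro p hp
      obtain ⟨tl, rfl⟩ := List.head?_eq_some_iff.1 hp
      obtain ⟨lab, -, hrun⟩ := (hiff _).2 rfl
      exact hrun.fst_le
    refine ⟨_, hiff, ?_, ?_, ?_, ?_, ?_⟩
    · simp [hr.length_eq]
    · intro p hp
      rcases List.mem_cons.1 hp with rfl | hp
      · change 3 ≤ j.val
        omega
      · obtain ⟨q, hq, rfl⟩ := List.mem_map.1 hp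
        exact (hr.three_le q hq).trans (le_succAbove _ _)
    · simpa using hi
    · simp only [List.head?_cons, Option.mem_def, Option.some.injEq, forall_eq']
      intro p hp'
      rcases List.mem_cons.1 hp' with rfl | hp'
      · exact hf.lt.ne'
      · obtain ⟨q, hq, rfl⟩ := List.mem_map.1 hp'
        rcases hadv with ⟨⟨u, hu, huj, hiu⟩, rfl, rfl⟩ | ⟨-, rfl, rfl⟩
        -- Suppose `i` advances and wins later. The leaf `u` that triggered laziness forms with `i`
        -- a cherry of `B` in which `i` is the smaller label, so the first loser of `B` is at least
        -- `i`. By `hle` it is `i`, which by induction never wins in `B`.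
        · intro hqi
          obtain ⟨u, rfl⟩ := Fin.exists_succAbove_eq huj
          change drop.succAbove q.2 = keep at hqi
          have huq : u ≠ q.2 := by
            rintro rfl
            exact hiu.ne' hqi
          obtain ⟨v', w', hc⟩ := (hp.adj_third_iff hqi huq).1 hu
          have hqu : q.2 < u := Fin.succAbove_lt_succAbove_iff.1 (hqi ▸ hiu)
          obtain ⟨p, tl, rfl⟩ := List.exists_cons_of_ne_nil (List.ne_nil_of_mem hq)
          have h1 : p.1 ≤ q.2 := by
            have := hle p rfl
            rw [← hqi] at this
            exact Fin.succAbove_le_succAbove_iff.1 this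
          have h2 : q.2 ≤ p.1 := by
            obtain ⟨m, rfl⟩ : ∃ m, n = m + 1 := ⟨tl.length, by simpa using hr.length_eq.symm⟩
            obtain ⟨lab, h0, hrun⟩ := (hrs _).2 rfl
            cases hrun with
            | round _ a b E _ hfo _ =>
              exact hfo.2 _ _ _ (h0.canFaceOff_iff.2 ⟨hqu, v', w', hc, rfl⟩)
          exact hr.head_ne p rfl q hq (le_antisymm h2 h1)
        · exact Fin.succAbove_ne _ _
    · intro x hx hhead
      have hxi : i < x := hhead (i, j) rfl
      by_cases hxj : x = j
      · exact ⟨_, List.mem_cons_self, hxj.symm⟩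
      · have hxd : x ≠ drop := by
          rcases hadv with ⟨-, rfl, rfl⟩ | ⟨-, rfl, rfl⟩
          · exact hxj
          · exact hxi.ne'
        obtain ⟨x, rfl⟩ := Fin.exists_succAbove_eq hxd
        have hlt : ∀ p ∈ rs.head?, p.1 < x := fun p hp =>
          Fin.succAbove_lt_succAbove_iff.1 ((hle p hp).trans_lt hxi)
        -- Closing up the labels could turn 1 into c. The first loser of `B` is at least c and below
        -- `x`, which excludes this; for `n = 0` there is no numeric label besides `j`.
        have hx3 : 3 ≤ x.val := by
          rcases rs with _ | ⟨p, tl⟩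
          · have hn : 0 = n := hr.length_eq
            have h1 : (drop.succAbove x).val ≠ j.val := fun h => hxj (Fin.ext h)
            omega
          · have h1 : 2 ≤ p.1.val := hr.head_ge p rfl
            have h2 : p.1.val < x.val := hlt p rfl
            omega
        obtain ⟨q, hq, hqx⟩ := hr.exists_win x hx3 hlt
        exact ⟨_, List.mem_cons_of_mem _ (List.mem_map_of_mem hq), by simp [hqx]⟩

end TrivalentTree

section Rightmost

variable {n : ℕ}

theorem rightmost_spec {p : Fin (n + 1) → Prop} [DecidablePred p] (h : ∃ c, p c) :
    p (rightmost p) := by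
  obtain ⟨c, hc⟩ := h
  obtain ⟨d, hd, he⟩ := Finset.exists_mem_eq_sup (Finset.univ.filter p)
    ⟨c, Finset.mem_filter.2 ⟨Finset.mem_univ _, hc⟩⟩ id
  have : rightmost p = d := he
  rw [this]
  exact (Finset.mem_filter.1 hd).2

theorem le_rightmost {p : Fin (n + 1) → Prop} [DecidablePred p] {c : Fin (n + 1)} (h : p c) :
    c ≤ rightmost p :=
  Finset.le_sup (f := id) (Finset.mem_filter.2 ⟨Finset.mem_univ _, h⟩)

theorem rightmost_eq {p : Fin (n + 1) → Prop} [DecidablePred p] {c : Fin (n + 1)} (h : p c)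
    (hc : ∀ d, p d → d ≤ c) : rightmost p = c :=
  le_antisymm (hc _ (rightmost_spec ⟨c, h⟩)) (le_rightmost h)

theorem rightmost_congr {p q : Fin (n + 1) → Prop} [DecidablePred p] [DecidablePred q]
    (h : ∀ c, p c ↔ q c) : rightmost p = rightmost q := by
  unfold rightmost
  congr 1
  ext c
  simp [h]

end Rightmost

/-! ### Removing car 1 from a parking function. -/

namespace Filling

variable {n : ℕ}

theorem height_eq (P : Filling (n + 1)) (c : Fin (n + 1)) :
    P.height c = (if P 0 = c then 1 else 0) +
      (Finset.univ.filter fun m : Fin n => P m.succ = c).card := by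
  unfold height
  rw [Finset.card_filter, Finset.card_filter, Fin.sum_univ_succ]

theorem update_height (P : Filling (n + 1)) {k : Fin (n + 1) → ℕ} (hk : ∀ c, P.height c = k c)
    (c : Fin (n + 1)) : Function.update k (P 0) (k (P 0) - 1) c =
      (Finset.univ.filter fun m : Fin n => P m.succ = c).card := by
  by_cases hc : c = P 0
  · subst hc
    rw [Function.update_self, ← hk, height_eq, if_pos rfl]
    omega
  · rw [Function.update_of_ne hc, ← hk, height_eq, if_neg (Ne.symm hc), zero_add]

theorem rightmostEmpty_eq (P : Filling (n + 1)) {k : Fin (n + 1) → ℕ}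
    (hk : ∀ c, P.height c = k c) :
    P.rightmostEmpty = rightmost fun c => Function.update k (P 0) (k (P 0) - 1) c = 0 := by
  unfold rightmostEmpty
  apply rightmost_congr
  intro c
  rw [P.update_height hk, Finset.card_eq_zero, Finset.filter_eq_empty_iff]
  simp

theorem succAbove_r (P : Filling (n + 1)) (m : Fin n) :
    P.rightmostEmpty.succAbove (P.r m) = P m.succ := by
  have := congrArg Subtype.val ((finSuccAboveEquiv P.rightmostEmpty).apply_symm_apply
    ⟨P m.succ, P.ne_rightmostEmpty m⟩)
  exact this

theorem height_r (P : Filling (n + 1)) {k : Fin (n + 1) → ℕ} (hk : ∀ c, P.height c = k c)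
    (c : Fin n) : P.r.height c = tilde k (P 0) c := by
  unfold tilde
  rw [P.update_height hk, ← P.rightmostEmpty_eq hk]
  unfold height
  congr 1
  ext m
  simp [← P.succAbove_r]

theorem exists_of_rightmostEmpty_lt (P : Filling (n + 1)) {c : Fin n}
    (hc : P.rightmostEmpty < P.rightmostEmpty.succAbove c) : ∃ m, P.r m = c := by
  by_contra! h
  refine hc.not_ge (le_rightmost fun m => ?_)
  rw [← P.succAbove_r m]
  exact fun h' => h m (Fin.succAbove_right_injective h')

theorem dominates_succ_rightmostEmpty (P : Filling (n + 1)) (m : Fin n) :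
    P.Dominates m.succ P.rightmostEmpty ↔ P m.succ < P.rightmostEmpty := by
  refine and_iff_left fun y hy hlt => ?_
  induction y using Fin.cases with
  | zero => exact absurd hlt (Fin.not_lt_zero _)
  | succ y => exact P.ne_rightmostEmpty y hy

theorem dominates_succ_succAbove (P : Filling (n + 1)) (m c : Fin n) :
    P.Dominates m.succ (P.rightmostEmpty.succAbove c) ↔ P.r.Dominates m c := by
  unfold Dominates
  rw [← P.succAbove_r, Fin.succAbove_lt_succAbove_iff]
  refine and_congr_right fun _ => ?_
  rw [Fin.forall_fin_succ]
  simp only [← P.succAbove_r, Fin.succAbove_right_inj, Fin.succ_lt_succ_iff]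
  simp

/-- Car 1 never prevents a larger car from dominating a column, so only the deleted column is lost,
and it counts for the cars to its left. -/
theorem dominanceIndex_succ (P : Filling (n + 1)) (m : Fin n) :
    P.dominanceIndex m.succ =
      (if P m.succ < P.rightmostEmpty then 1 else 0) + P.r.dominanceIndex m := by
  classical
  unfold dominanceIndex
  rw [Finset.card_filter, Finset.card_filter, Fin.sum_univ_succAbove _ P.rightmostEmpty]
  simp only [dominates_succ_rightmostEmpty, dominates_succ_succAbove]

/-- For a car left of the deleted column, both sides of the inequality drop by one. For any other
car, every column to its right is occupied in `P.r`, so each dominated column contains a smaller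
car. There are `m` smaller cars, and both inequalities hold. -/
theorem dominanceIndex_succ_lt_iff (P : Filling (n + 1)) (m : Fin n) :
    P.dominanceIndex m.succ < m.succ.val + 1 ↔ P.r.dominanceIndex m < m.val + 1 := by
  classical
  rw [dominanceIndex_succ, Fin.val_succ]
  split_ifs with h
  · omega
  · have hle : P.r.dominanceIndex m ≤ m.val := by
      have hsub : (Finset.univ.filter fun c => P.r.Dominates m c) ⊆
          (Finset.Iio m).image P.r := by
        intro c hc
        obtain ⟨hlt, hc⟩ := (Finset.mem_filter.1 hc).2
        obtain ⟨y, rfl⟩ := P.exists_of_rightmostEmpty_lt (c := c) (by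
          have := Fin.succAbove_lt_succAbove_iff (p := P.rightmostEmpty).2 hlt
          rw [P.succAbove_r] at this
          exact (not_lt.1 h).trans_lt this)
        refine Finset.mem_image.2 ⟨y, Finset.mem_Iio.2 ?_, rfl⟩
        refine lt_of_le_of_ne (not_lt.1 (hc y rfl)) ?_
        rintro rfl
        exact lt_irrefl _ hlt
      have := (Finset.card_le_card hsub).trans Finset.card_image_le
      rwa [Fin.card_Iio] at this
    omega

/-- Every other car is greater than car 1, so the columns it dominates are the empty ones to its
right. -/
theorem dominanceIndex_zero_lt_iff (P : Filling (n + 1)) {k : Fin (n + 1) → ℕ}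
    (hk : ∀ c, P.height c = k c) : P.dominanceIndex 0 < (0 : Fin (n + 1)).val + 1 ↔
      AboveZeros k (P 0) := by
  classical
  have hzero : ∀ c, k c = 0 ↔ ∀ m, P m ≠ c := fun c => by
    rw [← hk]
    unfold height
    rw [Finset.card_eq_zero, Finset.filter_eq_empty_iff]
    simp
  rw [Fin.val_zero, zero_add, Nat.lt_one_iff]
  unfold dominanceIndex AboveZeros
  rw [Finset.card_eq_zero, Finset.filter_eq_empty_iff]
  constructor
  · intro h l hl
    rw [hzero] at hl
    by_contra hlt
    refine h (Finset.mem_univ l) ⟨lt_of_le_of_ne (not_lt.1 hlt) (hl 0), fun y hy => ?_⟩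
    exact absurd hy (hl y)
  · rintro h c - ⟨hlt, hc⟩
    refine (h c ?_).not_gt hlt
    rw [hzero]
    rintro m rfl
    refine hc m rfl (Fin.pos_iff_ne_zero.2 ?_)
    rintro rfl
    exact lt_irrefl _ hlt

theorem isParking_iff (P : Filling n) :
    P.IsParking ↔ ∀ c : Fin n, (Finset.univ.filter fun m => P m ≤ c).card ≤ c.val + 1 := by
  unfold IsParking
  refine forall_congr' fun c => ?_
  have : ∑ c' ∈ Finset.Iic c, P.height c' = (Finset.univ.filter fun m => P m ≤ c).card := by
    rw [Finset.card_eq_sum_card_fiberwise (f := P) (t := Finset.Iic c)]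
    · refine Finset.sum_congr rfl fun c' hc' => ?_
      unfold height
      congr 1
      ext m
      have := Finset.mem_Iic.1 hc'
      simp only [Finset.mem_filter, Finset.mem_univ, true_and]
      exact ⟨fun h => ⟨h ▸ this, h⟩, fun h => h.2⟩
    · intro m hm
      simpa using hm
  rw [this]

theorem card_le_succ (P : Filling (n + 1)) (c : Fin (n + 1)) :
    (Finset.univ.filter fun m => P m ≤ c).card = (if P 0 ≤ c then 1 else 0) +
      (Finset.univ.filter fun m => P.rightmostEmpty.succAbove (P.r m) ≤ c).card := by
  rw [Finset.card_filter, Finset.card_filter, Fin.sum_univ_succ]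
  simp only [succAbove_r]

/-- Left of the deleted column the counts agree, as car 1 is not there. From that column on, both
bounds are automatic: in `P.r` each column to the right of `c` has a car, which limits the number of
cars up to `c`; in `P` the columns up to `c` hold car 1 and cars from `c` columns of `P.r`. -/
theorem isParking_r_iff (P : Filling (n + 1)) (hz : P.rightmostEmpty ≤ P 0) :
    P.IsParking ↔ P.r.IsParking := by
  rw [isParking_iff, isParking_iff]
  constructor
  · intro h c
    by_cases hc : c.castSucc < P.rightmostEmpty
    · have h1 := h c.castSucc
      rw [card_le_succ, ← Fin.succAbove_of_castSucc_lt _ _ hc] at h1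
      simp only [Fin.succAbove_le_succAbove_iff] at h1
      rw [Fin.succAbove_of_castSucc_lt _ _ hc, Fin.val_castSucc] at h1
      omega
    · have hsub : Finset.Ioi c ⊆ (Finset.univ.filter fun m => ¬ P.r m ≤ c).image P.r := by
        intro d hd
        have hcd := Finset.mem_Ioi.1 hd
        have hzd : P.rightmostEmpty ≤ d.castSucc :=
          (not_lt.1 hc).trans (Fin.castSucc_lt_castSucc_iff.2 hcd).le
        obtain ⟨m, rfl⟩ := P.exists_of_rightmostEmpty_lt (c := d) (by
          rw [Fin.succAbove_of_le_castSucc _ _ hzd]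
          exact hzd.trans_lt d.castSucc_lt_succ)
        exact Finset.mem_image.2 ⟨m, by simpa using hcd, rfl⟩
      have h1 := (Finset.card_le_card hsub).trans Finset.card_image_le
      have h2 := Finset.card_filter_add_card_filter_not (s := Finset.univ) fun m => P.r m ≤ c
      rw [Fin.card_Ioi] at h1
      rw [Finset.card_univ, Fintype.card_fin] at h2
      omega
  · intro h c
    rw [card_le_succ]
    by_cases hc : c < P.rightmostEmpty
    · obtain ⟨d, hd⟩ := Fin.exists_succAbove_eq hc.ne
      have hdc : c = d.castSucc := by
        rw [← hd]
        refine Fin.succAbove_of_castSucc_lt _ _ (not_le.1 fun hle => ?_)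
        rw [Fin.succAbove_of_le_castSucc _ _ hle] at hd
        exact hc.not_ge (hle.trans (d.castSucc_lt_succ.le.trans hd.le))
      have h1 := h d
      rw [if_neg (hc.trans_le hz).not_ge]
      conv_lhs => rw [← hd]
      simp only [Fin.succAbove_le_succAbove_iff]
      rw [hdc, Fin.val_castSucc]
      omega
    · have key : ∀ m, P.rightmostEmpty.succAbove (P.r m) ≤ c ↔ (P.r m).val < c.val := by
        intro m
        have hc : P.rightmostEmpty.val ≤ c.val := not_lt.1 hc
        unfold Fin.succAbove
        split_ifs with h1
        · rw [Fin.lt_def, Fin.val_castSucc] at h1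
          rw [Fin.le_def, Fin.val_castSucc]
          omega
        · rw [Fin.le_def, Fin.val_succ]
          omega
      simp only [key]
      have : (Finset.univ.filter fun m => (P.r m).val < c.val).card ≤ c.val := by
        rcases Nat.eq_zero_or_pos c.val with h0 | h0
        · simp [h0]
        · have h1 := h ⟨c.val - 1, by omega⟩
          have h2 : ∀ m, P.r m ≤ ⟨c.val - 1, by omega⟩ ↔ (P.r m).val < c.val := fun m => by
            rw [Fin.le_def]
            simp only
            omega
          simp only [h2] at h1
          omega
      split_ifs <;> omega

/-- Removing the first car characterizes column-restricted parking functions recursively. -/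
theorem mem_CPF_iff (P : Filling (n + 1)) {k : Fin (n + 1) → ℕ} (hk : ∀ c, P.height c = k c) :
    P ∈ CPF k ↔ AboveZeros k (P 0) ∧ P.r ∈ CPF (tilde k (P 0)) := by
  have hcol : P.IsColumnRestricted ↔ AboveZeros k (P 0) ∧ P.r.IsColumnRestricted := by
    unfold IsColumnRestricted
    rw [Fin.forall_fin_succ, P.dominanceIndex_zero_lt_iff hk]
    simp only [dominanceIndex_succ_lt_iff]
  -- A deleted column to the right of car 1 would already be empty in `P`.
  have hz : AboveZeros k (P 0) → P.rightmostEmpty ≤ P 0 := by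
    intro h
    by_contra hlt
    have hlt := not_le.1 hlt
    refine (h P.rightmostEmpty ?_).not_gt hlt
    rw [← hk, height_eq, if_neg hlt.ne, zero_add, Finset.card_eq_zero,
      Finset.filter_eq_empty_iff]
    exact fun m _ => P.ne_rightmostEmpty m
  constructor
  · rintro ⟨h1, h2, -⟩
    obtain ⟨ha, h2⟩ := hcol.1 h2
    exact ⟨ha, (P.isParking_r_iff (hz ha)).1 h1, h2, P.height_r hk⟩
  · rintro ⟨ha, h1, h2, -⟩
    exact ⟨(P.isParking_r_iff (hz ha)).2 h1, hcol.2 ⟨ha, h2⟩, hk⟩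

end Filling

/-! ### The first loser and the dropped label in terms of `k`. -/

section Num

variable {n : ℕ}

theorem num_val (j : Fin n) : (num j).val = j.val + 3 := rfl

theorem num_injective : Function.Injective (num : Fin n → Label n) := fun a b h => by
  have := congrArg Fin.val h
  rw [num_val, num_val] at this
  exact Fin.ext (by omega)

theorem num_lt_num {a b : Fin n} : num a < num b ↔ a < b := by
  rw [Fin.lt_def, num_val, num_val, Fin.lt_def]
  omega

theorem exists_num_eq {x : Label n} (h : 3 ≤ x.val) : ∃ j, num j = x :=
  ⟨⟨x.val - 3, by omega⟩, Fin.ext (by rw [num_val]; simp only; omega)⟩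

theorem succAbove_num (z : Fin (n + 1)) (x : Fin n) :
    (num z).succAbove (num x) = num (z.succAbove x) := by
  rcases lt_or_ge x.castSucc z with h | h
  · rw [Fin.succAbove_of_castSucc_lt _ _ h, Fin.succAbove_of_castSucc_lt]
    · rfl
    · rw [Fin.lt_def, Fin.val_castSucc] at h ⊢
      rw [num_val, num_val]
      omega
  · rw [Fin.succAbove_of_le_castSucc _ _ h, Fin.succAbove_of_le_castSucc]
    · ext
      simp only [Fin.val_succ, num_val]
    · rw [Fin.le_def, Fin.val_castSucc] at h ⊢
      rw [num_val, num_val]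
      omega

/-- `i` is the largest label that is `c` or a number `l` with `k_l = 0`. -/
structure IsLastZero (k : Fin n → ℕ) (i : Label n) : Prop where
  two_le : 2 ≤ i.val
  eq_zero : ∀ l, num l = i → k l = 0
  ne_zero : ∀ l, i < num l → k l ≠ 0

theorem IsLastZero.unique {k : Fin n → ℕ} {i i' : Label n} (h : IsLastZero k i)
    (h' : IsLastZero k i') :
    i = i' := by
  have key : ∀ a b : Label n, IsLastZero k a → IsLastZero k b → ¬ a < b := by
    intro a b ha hb hab
    have : a.val < b.val := hab
    have := ha.two_le
    obtain ⟨l, rfl⟩ := exists_num_eq (x := b) (by omega)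
    exact ha.ne_zero l hab (hb.eq_zero l rfl)
  exact le_antisymm (not_lt.1 (key _ _ h' h)) (not_lt.1 (key _ _ h h'))

theorem exists_isLastZero (k : Fin n → ℕ) : ∃ i, IsLastZero k i := by
  obtain ⟨i, hi, hmax⟩ := Set.exists_max_image {i : Label n | i.val = 2 ∨ ∃ l, num l = i ∧ k l = 0}
    id (Set.toFinite _) ⟨⟨2, by omega⟩, Or.inl rfl⟩
  refine ⟨i, hmax ⟨2, by omega⟩ (Or.inl rfl), ?_, ?_⟩
  · rintro l rfl
    rcases hi with hi | ⟨l', hl', h⟩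
    · rw [num_val] at hi
      omega
    · rwa [num_injective hl'] at h
  · intro l hl h
    exact hl.not_ge (hmax _ (Or.inr ⟨l, rfl, h⟩))

theorem IsLastZero.lt_of_aboveZeros {k : Fin n → ℕ} {i : Label n} (h : IsLastZero k i) {j : Fin n}
    (hj : AboveZeros k j) : i < num j := by
  rcases Nat.lt_or_ge i.val 3 with h3 | h3
  · rw [Fin.lt_def, num_val]
    omega
  · obtain ⟨l, rfl⟩ := exists_num_eq h3
    exact num_lt_num.2 (hj l (h.eq_zero l rfl))

theorem IsLastZero.aboveZeros {k : Fin n → ℕ} {i : Label n} (h : IsLastZero k i) {j : Fin n}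
    (hj : i < num j) : AboveZeros k j := fun l hl =>
  num_lt_num.1 ((not_lt.1 fun h' => h.ne_zero l h' hl).trans_lt hj)

/-- The label that `π_lazy` removes, when `i` loses the first round against `j`. -/
def dropped (k : Fin n → ℕ) (i : Label n) (j : Fin n) : Label n := if 1 < k j then i else num j

/-- The label that `π_lazy` gives to a new leaf, when `i` loses the first round against `j`. -/
def kept (k : Fin n → ℕ) (i : Label n) (j : Fin n) : Label n := if 1 < k j then num j else i

theorem two_le_kept_and_dropped {k : Fin n → ℕ} {i : Label n} {j : Fin n} (h : 2 ≤ i.val) :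
    2 ≤ (kept k i j).val ∧ 2 ≤ (dropped k i j).val := by
  have := num_val j
  unfold kept dropped
  split_ifs <;> omega

/-- The label that `π_lazy` removes belongs to the column that `r` removes. -/
theorem dropped_eq (P : Filling (n + 1)) {k : Fin (n + 1) → ℕ} (hk : ∀ c, P.height c = k c)
    {i : Label (n + 1)} (hi : IsLastZero k i) (hj : i < num (P 0)) :
    dropped k i (P 0) = num P.rightmostEmpty := by
  have hk' : ∀ c, c ≠ P 0 → Function.update k (P 0) (k (P 0) - 1) c = k c := fun c hc =>
    Function.update_of_ne hc _ _
  unfold dropped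
  rw [P.rightmostEmpty_eq hk]
  split_ifs with h1
  -- No column becomes empty here. Since some column is empty after the removal, `i` is a number and
  -- not c.
  · have hle : ∀ d, Function.update k (P 0) (k (P 0) - 1) d = 0 → k d = 0 ∧ num d ≤ i := by
      intro d hd
      have hd0 : d ≠ P 0 := by
        rintro rfl
        rw [Function.update_self] at hd
        omega
      rw [hk' d hd0] at hd
      exact ⟨hd, not_lt.1 fun h' => hi.ne_zero d h' hd⟩
    have hz : Function.update k (P 0) (k (P 0) - 1) P.rightmostEmpty = 0 := by
      rw [P.update_height hk, Finset.card_eq_zero, Finset.filter_eq_empty_iff]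
      exact fun m _ => P.ne_rightmostEmpty m
    have h2 : (num P.rightmostEmpty).val ≤ i.val := (hle _ hz).2
    rw [num_val] at h2
    obtain ⟨l, rfl⟩ := exists_num_eq (x := i) (by omega)
    rw [rightmost_eq (c := l)]
    · rw [hk' l fun h => hj.ne (h ▸ rfl)]
      exact hi.eq_zero l rfl
    · exact fun d hd => not_lt.1 fun h => (num_lt_num.2 h).not_ge (hle d hd).2
  -- The column of car 1 becomes empty, and it lies to the right of all zeros of `k`.
  · rw [rightmost_eq (c := P 0)]
    · rw [Function.update_self]
      omega
    · intro d hd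
      by_cases hd0 : d = P 0
      · exact hd0.le
      · rw [hk' d hd0] at hd
        exact (hi.aboveZeros hj d hd).le

end Num

theorem List.card_filter_get_eq_countP {α : Type*} (p : α → Prop) [DecidablePred p] (l : List α)
    {n : ℕ} (h : l.length = n) :
    (Finset.univ.filter fun m : Fin n => p (l[m.val]'(by omega))).card =
      l.countP (fun a => p a) := by
  subst h
  induction l with
  | nil => simp
  | cons a l ih =>
    rw [Finset.card_filter]
    change ∑ m : Fin (l.length + 1), _ = _
    rw [Fin.sum_univ_succ, List.countP_cons, ← ih, Finset.card_filter, add_comm]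
    by_cases h : p a <;> simp [h]

open TrivalentTree

/-! ### The filling of a tree. -/

section Tau

variable {n : ℕ}

/-- The class of a tree up to isomorphism. -/
def TrivalentTree.toClass (A : TrivalentTree n) : TreeClass n := Quotient.mk _ A

theorem TrivalentTree.toClass_eq_iff {A B : TrivalentTree n} : A.toClass = B.toClass ↔ A ≈ B :=
  Quotient.eq

theorem TreeClass.exists_toClass_eq (T : TreeClass n) : ∃ A : TrivalentTree n, A.toClass = T :=
  Quotient.exists_rep T

variable {A : TrivalentTree n} {rs : List (Label n × Label n)}

theorem TrivalentTree.exists_getElem (hA : A.ABShareVertex) (hrs : A.IsTournament rs) (m : Fin n) :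
    ∃ h : m.val < rs.length, (rs[m.val]).2 = num (tau A.toClass m) := by
  obtain ⟨rs', huniq, hr⟩ := A.exists_tournament hA
  obtain rfl := (huniq _).1 hrs
  have hm : m.val < rs.length := by rw [hr.length_eq]; exact m.2
  refine ⟨hm, ?_⟩
  obtain ⟨j, hj⟩ := exists_num_eq (hr.three_le _ (List.getElem_mem hm))
  have hex : ∃ j, A.toClass.WinsRound j m :=
    ⟨j, rs, hrs, rs[m.val].1, by rw [hj, List.getElem?_eq_getElem hm]⟩
  have : A.toClass.WinsRound (tau A.toClass m) m := Classical.epsilon_spec hex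
  obtain ⟨rs', h1, i, h2⟩ := this
  obtain rfl := (huniq _).1 h1
  rw [List.getElem?_eq_getElem hm, Option.some.injEq] at h2
  rw [h2]

theorem TrivalentTree.tau_eq_iff (hA : A.ABShareVertex) (m j : Fin n) :
    tau A.toClass m = j ↔ A.toClass.WinsRound j m := by
  obtain ⟨rs, huniq, hr⟩ := A.exists_tournament hA
  obtain ⟨hm, h⟩ := exists_getElem hA ((huniq _).2 rfl) m
  constructor
  · rintro rfl
    exact ⟨rs, (huniq _).2 rfl, rs[m.val].1, by rw [← h, List.getElem?_eq_getElem hm]⟩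
  · rintro ⟨rs', h1, i, h2⟩
    obtain rfl := (huniq _).1 h1
    rw [List.getElem?_eq_getElem hm, Option.some.injEq] at h2
    rw [h2] at h
    exact (num_injective h).symm

theorem TrivalentTree.height_tau (hA : A.ABShareVertex) (hrs : A.IsTournament rs) (c : Fin n) :
    (tau A.toClass).height c = rs.countP (fun p => p.2 = num c) := by
  obtain ⟨rs', huniq, hr⟩ := A.exists_tournament hA
  obtain rfl := (huniq _).1 hrs
  rw [← List.card_filter_get_eq_countP (fun p : Label n × Label n => p.2 = num c) rs hr.length_eq]
  unfold Filling.height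
  congr 1
  ext m
  obtain ⟨hm, h⟩ := exists_getElem hA hrs m
  simp only [Finset.mem_filter, Finset.mem_univ, true_and, h, num_injective.eq_iff]

theorem TrivalentTree.toClass_mem_tour_iff {k : Fin n → ℕ} :
    A.toClass ∈ Tour k ↔ A.ABShareVertex ∧
      ∃ rs, A.IsTournament rs ∧ ∀ j, rs.countP (fun p => p.2 = num j) = k j := Iff.rfl

/-- The first loser is determined by the number of wins of each label. -/
theorem TrivalentTree.IsFirst.isLastZero {A : TrivalentTree (n + 1)} {k : Fin (n + 1) → ℕ}
    (hA : A.toClass ∈ Tour k) {i j : Label (n + 1)} {v w : A.V} (h : A.IsFirst i j v w) :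
    IsLastZero k i := by
  obtain ⟨hAB, rs, hrs, hk⟩ := toClass_mem_tour_iff.1 hA
  obtain ⟨rs', huniq, hr⟩ := A.exists_tournament hAB
  obtain rfl := (huniq _).1 hrs
  obtain ⟨tl, rfl, -⟩ := h.isTournament_iff.1 hrs
  refine ⟨h.two_le hAB, ?_, ?_⟩
  · rintro l rfl
    rw [← hk, List.countP_eq_zero]
    intro p hp
    simpa using hr.head_ne _ rfl p hp
  · intro l hl h0
    obtain ⟨q, hq, hql⟩ := hr.exists_win (num l) (by rw [num_val]; omega) (by
      intro p hp
      obtain rfl : (i, j) = p := by simpa using hp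
      exact hl)
    rw [← hk, List.countP_eq_zero] at h0
    exact h0 q hq (by simpa using hql)

end Tau

/-! ### One step of the induction: the commutative square and its lifting property. -/

section Step

variable {n : ℕ} {A : TrivalentTree (n + 1)} {B : TrivalentTree n} {k : Fin (n + 1) → ℕ}
  {i : Label (n + 1)} {j : Fin (n + 1)} {v w : A.V} {φ : B.G ↪g A.G}

theorem tau_of_isTournament (hA : A.ABShareVertex) (hB : B.ABShareVertex) {z : Fin (n + 1)}
    {rs : List (Label n × Label n)}
    (h : A.IsTournament ((i, num j) :: rs.map (Prod.map (num z).succAbove (num z).succAbove)))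
    (h' : B.IsTournament rs) :
    tau A.toClass 0 = j ∧ ∀ m, tau A.toClass m.succ = z.succAbove (tau B.toClass m) := by
  constructor
  · obtain ⟨h0, h1⟩ := exists_getElem hA h 0
    exact (num_injective h1).symm
  · intro m
    obtain ⟨h0, h1⟩ := exists_getElem hA h m.succ
    obtain ⟨h0', h1'⟩ := exists_getElem hB h' m
    apply num_injective
    rw [← h1, ← succAbove_num, ← h1']
    simp

/-- This reconciles the choice by `k_j` in `π_lazy` with the laziness rule: the later rounds are
those of the tree pruned by `π_lazy`. -/
theorem TrivalentTree.IsFirst.exists_isTournament (hA : A.toClass ∈ Tour k)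
    (hf : A.IsFirst i (num j) v w)
    (hp : A.PrunesTo v w (kept k i j) (dropped k i j) B φ) :
    ∃ rs, A.IsTournament ((i, num j) ::
      rs.map (Prod.map (dropped k i j).succAbove (dropped k i j).succAbove)) ∧
      B.IsTournament rs := by
  obtain ⟨hAB, rs, hrs, hk⟩ := toClass_mem_tour_iff.1 hA
  obtain ⟨tl, rfl, -⟩ := hf.isTournament_iff.1 hrs
  have hkj := hk j
  rw [List.countP_cons_of_pos (by simp)] at hkj
  -- If the loser advances, `j` leaves the tree and cannot win again; so `k_j > 1` forces `j` to
  -- advance.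
  have key : A.LoserAdvances w i (num j) → ∀ p ∈ tl, p.2 ≠ num j := by
    intro hl
    obtain ⟨B, φ, hp⟩ := hf.cherry.exists_prunesTo
    obtain ⟨rs', he, -⟩ := (hf.isTournament_iff_of_prunesTo hp (Or.inl ⟨hl, rfl, rfl⟩)).1 hrs
    intro p hp
    rw [(List.cons.inj he).2] at hp
    obtain ⟨q, -, rfl⟩ := List.mem_map.1 hp
    exact Fin.succAbove_ne _ _
  unfold kept dropped at *
  split_ifs at * with h1
  · have hl : ¬ A.LoserAdvances w i (num j) := by
      intro hl
      have : tl.countP (fun p => p.2 = num j) = 0 := by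
        rw [List.countP_eq_zero]
        intro p hp
        simpa using key hl p hp
      omega
    obtain ⟨rs', he, hB⟩ :=
      (hf.isTournament_iff_of_prunesTo hp (Or.inr ⟨hl, rfl, rfl⟩)).1 hrs
    exact ⟨rs', he ▸ hrs, hB⟩
  · have htl : ∀ p ∈ tl, p.2 ≠ num j := by
      have : tl.countP (fun p => p.2 = num j) = 0 := by omega
      rw [List.countP_eq_zero] at this
      intro p hp
      simpa using this p hp
    -- Now `j` wins only once. Either `i` advances, or the `j` that advances can be replaced by `i`.
    by_cases hl : A.LoserAdvances w i (num j)
    · obtain ⟨rs', he, hB⟩ :=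
        (hf.isTournament_iff_of_prunesTo hp (Or.inl ⟨hl, rfl, rfl⟩)).1 hrs
      exact ⟨rs', he ▸ hrs, hB⟩
    · obtain ⟨rs', rfl, hB⟩ := hf.exists_isTournament_of_not_loserAdvances hp hl hrs htl
      exact ⟨rs', hrs, hB⟩

theorem countP_map_succAbove (z : Fin (n + 1)) (c : Fin n) (rs : List (Label n × Label n)) :
    (rs.map (Prod.map (num z).succAbove (num z).succAbove)).countP
      (fun p => p.2 = num (z.succAbove c)) = rs.countP (fun p => p.2 = num c) := by
  rw [List.countP_map]
  congr 1
  funext p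
  simp [← succAbove_num]

/-- Pruning commutes with removing the first car. -/
theorem TrivalentTree.IsFirst.toClass_mem_tour (hA : A.toClass ∈ Tour k)
    (hf : A.IsFirst i (num j) v w)
    (hp : A.PrunesTo v w (kept k i j) (dropped k i j) B φ) :
    B.toClass ∈ Tour (tilde k j) ∧ tau A.toClass 0 = j ∧ (tau A.toClass).r = tau B.toClass := by
  obtain ⟨rs, h, h'⟩ := hf.exists_isTournament hA hp
  obtain ⟨hAB, rs₀, hrs₀, hk⟩ := toClass_mem_tour_iff.1 hA
  obtain ⟨_, huniq, hr⟩ := A.exists_tournament hAB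
  obtain rfl := (huniq _).1 hrs₀
  obtain rfl := (huniq _).1 h
  have htop := hf.isLastZero hA
  have hkd := two_le_kept_and_dropped (k := k) (j := j) htop.two_le
  have hBB := (hp.abShareVertex_iff hkd.1 hkd.2).2 hAB
  have hheight : ∀ c, (tau A.toClass).height c = k c := fun c => by
    rw [height_tau hAB h, hk]
  have h0 : tau A.toClass 0 = j := by
    obtain ⟨_, h1⟩ := exists_getElem hAB h 0
    exact (num_injective h1).symm
  -- Closing up the labels of the tree now agrees with renumbering the columns.
  have hd := dropped_eq (tau A.toClass) hheight htop (by rw [h0]; exact hf.lt)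
  have hz := (tau A.toClass).rightmostEmpty_eq hheight
  rw [h0] at hd hz
  rw [hd] at h hk
  refine ⟨toClass_mem_tour_iff.2 ⟨hBB, rs, h', fun c => ?_⟩, h0, ?_⟩
  · unfold tilde
    rw [← hz, ← countP_map_succAbove (tau A.toClass).rightmostEmpty]
    have hk' := hk ((tau A.toClass).rightmostEmpty.succAbove c)
    rw [List.countP_cons] at hk'
    by_cases hc : (tau A.toClass).rightmostEmpty.succAbove c = j
    · rw [hc] at hk' ⊢
      rw [Function.update_self, ← hk']
      simp
    · rw [Function.update_of_ne hc, ← hk']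
      simp [num_injective.eq_iff, Ne.symm hc]
  · funext m
    have h1 := (tau_of_isTournament hAB hBB h h').2 m
    rw [← (tau A.toClass).succAbove_r] at h1
    exact Fin.succAbove_right_injective h1

theorem isPruning_iff {keep drop : Label (n + 1)} (hc : A.IsCherry v w keep drop) :
    A.IsPruning v keep drop B ↔ ∃ φ, A.PrunesTo v w keep drop B φ := by
  constructor
  · rintro ⟨φ, h1, h2⟩
    exact ⟨φ, hc, h1, fun y => by rw [h2]⟩
  · rintro ⟨φ, h⟩
    exact ⟨φ, h.range_eq, fun y => by rw [h.map_leaf]⟩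

theorem TrivalentTree.IsFirst.isCherry_kept (hf : A.IsFirst i (num j) v w) (k : Fin (n + 1) → ℕ) :
    A.IsCherry v w (kept k i j) (dropped k i j) := by
  unfold kept dropped
  split_ifs
  · exact hf.cherry.symm
  · exact hf.cherry

theorem isPiLazy_iff : A.IsPiLazy k j B ↔ ∃ i v w, A.IsFirst i (num j) v w ∧
    ∃ φ, A.PrunesTo v w (kept k i j) (dropped k i j) B φ := by
  unfold TrivalentTree.IsPiLazy
  simp only [firstFaceOff_iff]
  have key : ∀ i v, (if 1 < k j then A.IsPruning v (num j) i B else A.IsPruning v i (num j) B) ↔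
      A.IsPruning v (kept k i j) (dropped k i j) B := by
    intro i v
    unfold kept dropped
    split_ifs <;> rfl
  simp only [key]
  constructor
  · rintro ⟨i, v, ⟨w, hf⟩, hp⟩
    exact ⟨i, v, w, hf, (isPruning_iff (hf.isCherry_kept k)).1 hp⟩
  · rintro ⟨i, v, w, hf, hp⟩
    exact ⟨i, v, ⟨w, hf⟩, (isPruning_iff (hf.isCherry_kept k)).2 hp⟩

theorem TrivalentTree.IsFirst.map {A' : TrivalentTree (n + 1)} {j : Label (n + 1)}
    (hf : A.IsFirst i j v w) (ψ : A.G ≃g A'.G) (hψ : ∀ x, ψ (A.leaf x) = A'.leaf x) :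
    A'.IsFirst i j (ψ v) (ψ w) := by
  refine ⟨hf.lt, hf.cherry.map ψ hψ, fun v' w' i' j' h hc => ?_⟩
  exact hf.le _ _ _ _ h (hc.map ψ.symm fun x => by rw [← hψ]; exact ψ.symm_apply_apply _)

/-- The first pair is preserved by isomorphisms and the pruned tree is unique up to isomorphism, so
the choice of representatives is immaterial. -/
theorem TrivalentTree.IsFirst.isPiLazy_toClass_iff (hf : A.IsFirst i (num j) v w)
    (hp : A.PrunesTo v w (kept k i j) (dropped k i j) B φ) (j' : Fin (n + 1))
    (T' : TreeClass n) : A.toClass.IsPiLazy k j' T' ↔ j' = j ∧ T' = B.toClass := by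
  constructor
  · rintro ⟨A', B', hA, rfl, h⟩
    obtain ⟨ψ, hψ⟩ : A' ≈ A := Quotient.exact hA
    obtain ⟨i', v', w', hf', φ', hp'⟩ := isPiLazy_iff.1 h
    obtain ⟨rfl, hj, rfl, rfl⟩ := hf.unique (hf'.map ψ hψ)
    obtain rfl := num_injective hj
    obtain ⟨φ'', hp''⟩ := hp'.map ψ hψ
    exact ⟨rfl, Quotient.sound (hp''.equiv hp)⟩
  · rintro ⟨rfl, rfl⟩
    exact ⟨A, B, rfl, rfl, isPiLazy_iff.2 ⟨i, v, w, hf, φ, hp⟩⟩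

theorem Tour.exists_prunesTo {T : TreeClass (n + 1)} (hT : T ∈ Tour k) :
    ∃ (A : TrivalentTree (n + 1)) (B : TrivalentTree n) (i : Label (n + 1)) (j : Fin (n + 1))
      (v w : A.V) (φ : B.G ↪g A.G), A.toClass = T ∧ A.IsFirst i (num j) v w ∧
        A.PrunesTo v w (kept k i j) (dropped k i j) B φ := by
  obtain ⟨A, rfl⟩ := T.exists_toClass_eq
  obtain ⟨i, j, v, w, hf, hi⟩ := A.exists_isFirst hT.1
  obtain ⟨j, rfl⟩ := exists_num_eq (x := j) (by have : i.val < j.val := hf.lt; omega)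
  obtain ⟨B, φ, hp⟩ := (hf.isCherry_kept k).exists_prunesTo
  exact ⟨A, B, i, j, v, w, φ, rfl, hf, hp⟩

/-- Every tree of `Tour (tilde k (P 0))` comes from one of `Tour k` by pruning. -/
theorem exists_tour_of_mem_tour_tilde {P : Filling (n + 1)} (hk : ∀ c, P.height c = k c)
    (hP : AboveZeros k (P 0)) (hB : B.toClass ∈ Tour (tilde k (P 0))) :
    ∃ T ∈ Tour k, tau T 0 = P 0 ∧
      ∀ m, tau T m.succ = P.rightmostEmpty.succAbove (tau B.toClass m) := by
  obtain ⟨i, hi⟩ := exists_isLastZero k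
  have hlt := hi.lt_of_aboveZeros hP
  have hd := dropped_eq P hk hi hlt
  have hz := P.rightmostEmpty_eq hk
  have hcases : 1 < k (P 0) ∧ kept k i (P 0) = num (P 0) ∧ dropped k i (P 0) = i ∨
      ¬ 1 < k (P 0) ∧ kept k i (P 0) = i ∧ dropped k i (P 0) = num (P 0) := by
    unfold kept dropped
    by_cases h : 1 < k (P 0) <;> simp [h]
  have hkd := two_le_kept_and_dropped (k := k) (j := P 0) hi.two_le
  generalize kept k i (P 0) = keep at *
  rw [hd] at hcases hkd
  have hz0 : Function.update k (P 0) (k (P 0) - 1) P.rightmostEmpty = 0 := by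
    rw [P.update_height hk, Finset.card_eq_zero, Finset.filter_eq_empty_iff]
    exact fun m _ => P.ne_rightmostEmpty m
  have hkj : 1 ≤ k (P 0) := by
    rw [← hk, P.height_eq, if_pos rfl]
    omega
  clear hk hd
  generalize P 0 = j at *
  generalize P.rightmostEmpty = z at *
  have hij : i.val < (num j).val := hlt
  obtain ⟨hBB, rs, hrs, hcount⟩ := toClass_mem_tour_iff.1 hB
  obtain ⟨_, huniq, hr⟩ := B.exists_tournament hBB
  obtain rfl := (huniq _).1 hrs
  have hne : keep ≠ num z := by
    rcases hcases with ⟨-, rfl, h⟩ | ⟨-, rfl, h⟩ <;> rw [h]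
    · exact hlt.ne'
    · exact hlt.ne
  obtain ⟨A, v, w, φ, hp⟩ := B.exists_prunesTo hne
  have hAB := (hp.abShareVertex_iff hkd.1 hkd.2).1 hBB
  have htilde : ∀ c, tilde k j c = Function.update k j (k j - 1) (z.succAbove c) := fun c => by
    unfold tilde
    rw [← hz]
  -- No zero of `tilde k j` comes from a column above `i`: only column `j` can become zero, and then
  -- it is the deleted one.
  have htop : ∀ a, IsLastZero (tilde k j) a → (num z).succAbove a ≤ i := by
    intro a ha
    by_contra hgt
    have hgt := not_le.1 hgt
    rcases Nat.lt_or_ge a.val 3 with h3 | h3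
    · rw [succAbove_of_lt (by rw [num_val]; omega)] at hgt
      have hgt : i.val < a.val := hgt
      have := hi.two_le
      omega
    · obtain ⟨l, rfl⟩ := exists_num_eq h3
      have h0 := ha.eq_zero l rfl
      rw [htilde] at h0
      rw [succAbove_num] at hgt
      have hl := hi.ne_zero _ hgt
      by_cases hlj : z.succAbove l = j
      · rw [hlj, Function.update_self] at h0
        rcases hcases with ⟨h1, -⟩ | ⟨-, -, h2⟩
        · omega
        · rw [num_injective h2] at hlj
          exact Fin.succAbove_ne _ _ hlj
      · rw [Function.update_of_ne hlj] at h0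
        exact hl h0
  -- The first loser of `B` bounds the smaller label of each cherry of `B`. For `n = 0` the smaller
  -- label is a or b, hence at most c after renaming.
  have hle : ∀ v' w' x y, x < y → B.IsCherry v' w' x y → (num z).succAbove x ≤ i := by
    intro v' w' x y hxy hc
    rcases n with _ | n
    · have h1 : ((num z).succAbove x).val ≤ x.val + 1 := by
        unfold Fin.succAbove
        split_ifs <;> simp
      have h2 : x.val < y.val := hxy
      have h3 := hi.two_le
      rw [Fin.le_def]
      omega
    · obtain ⟨a, b, v'', w'', hf, -⟩ := B.exists_isFirst hBB
      exact (Fin.succAbove_le_succAbove_iff.2 (hf.le _ _ _ _ hxy hc)).trans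
        (htop a (hf.isLastZero hB))
  have hcherry : A.IsCherry v w i (num j) := by
    rcases hcases with ⟨-, rfl, h⟩ | ⟨-, rfl, h⟩
    · rw [← h]; exact hp.cherry.symm
    · rw [← h]; exact hp.cherry
  have hfirst : A.IsFirst i (num j) v w := by
    refine ⟨hlt, hcherry, fun v' w' x y hxy hc => ?_⟩
    rcases hp.isCherry_cases hc with ⟨rfl, rfl⟩ | ⟨rfl, rfl⟩ | ⟨x, y, rfl, rfl, v'', w'', hc'⟩
    · rcases hcases with ⟨-, h1, h2⟩ | ⟨-, h1, h2⟩
      · rw [h1, h2] at hxy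
        exact absurd hxy hlt.not_gt
      · exact h1.le
    · rcases hcases with ⟨-, h1, h2⟩ | ⟨-, h1, h2⟩
      · exact h2.le
      · rw [h1, h2] at hxy
        exact absurd hxy hlt.not_gt
    · exact hle _ _ _ _ (Fin.succAbove_lt_succAbove_iff.1 hxy) hc'
  obtain ⟨y, hy⟩ := Fin.exists_succAbove_eq hne
  have hrun : A.IsTournament ((i, num j) ::
      rs.map (Prod.map (num z).succAbove (num z).succAbove)) := by
    rcases hcases with ⟨-, h1, h2⟩ | ⟨-, h1, h2⟩
    · refine (hfirst.isTournament_iff_of_prunesTo hp (Or.inr ⟨?_, h1, h2⟩)).2 ⟨rs, rfl, hrs⟩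
      -- A leaf `u` that triggers laziness would form with `j` a cherry of `B` with both labels
      -- above `i`, against `hle`.
      rintro ⟨u, hu, huj, hiu⟩
      obtain ⟨u, rfl⟩ := Fin.exists_succAbove_eq (show u ≠ num z from h2 ▸ hiu.ne')
      have huy : u ≠ y := by
        rintro rfl
        exact huj (hy.trans h1)
      obtain ⟨v', w', hc⟩ := (hp.adj_third_iff hy huy).1 hu
      rcases lt_or_gt_of_ne huy with h | h
      · exact hiu.not_ge (hle _ _ _ _ h hc.symm)
      · have := hle _ _ _ _ h hc
        rw [hy, h1] at this
        exact hlt.not_ge this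
    -- For `n = 0` there is a single round, so it is irrelevant which label advances.
    · rcases n with _ | n
      · obtain ⟨rsA, huniqA, hrA⟩ := A.exists_tournament hAB
        have hA := (huniqA _).2 rfl
        obtain ⟨tl, rfl, -⟩ := hfirst.isTournament_iff.1 hA
        obtain rfl : tl = [] := List.length_eq_zero_iff.1 (by simpa using hrA.length_eq)
        obtain rfl : rs = [] := List.length_eq_zero_iff.1 hr.length_eq
        exact hA
      · refine (hfirst.isTournament_iff_of_prunesTo hp (Or.inl ⟨?_, h1, h2⟩)).2 ⟨rs, rfl, hrs⟩
        obtain ⟨a, b, v', w', hf, ha2⟩ := B.exists_isFirst hBB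
        have ha := hf.isLastZero hB
        rw [h1] at hy
        have hay : a ≤ y := Fin.succAbove_le_succAbove_iff.1 (hy ▸ htop a ha)
        -- The leaf `i` of `A` is `y` in `B`. Were `y` above the last zero `a` of `tilde k j`, its
        -- entry would be nonzero, but `k` vanishes at `i`. So `i` loses first in `B`, and its
        -- opponent `b` triggers laziness in `A`.
        obtain rfl : a = y := by
          refine le_antisymm hay (not_lt.1 fun h => ?_)
          have h' : a.val < y.val := h
          obtain ⟨l, rfl⟩ := exists_num_eq (x := y) (by omega)
          have h0 := ha.ne_zero l h
          rw [succAbove_num] at hy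
          have h3 := hi.eq_zero _ hy
          rw [htilde, Function.update_of_ne] at h0
          · exact h0 h3
          · intro h4
            rw [h4] at hy
            exact hlt.ne hy.symm
        have hb : b ≠ a := hf.lt.ne'
        refine ⟨(num z).succAbove b, (hp.adj_third_iff (hy.trans h1.symm) hb).2
          ⟨v', w', hf.cherry⟩, ?_, ?_⟩
        · rw [← h2]
          exact Fin.succAbove_ne _ _
        · have := Fin.succAbove_lt_succAbove_iff (p := num z).2 hf.lt
          rwa [hy] at this
  refine ⟨A.toClass, toClass_mem_tour_iff.2 ⟨hAB, _, hrun, fun l => ?_⟩,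
    tau_of_isTournament hAB hBB hrun hrs⟩
  have hkl : k l = Function.update k j (k j - 1) l + if j = l then 1 else 0 := by
    by_cases h : j = l
    · subst h
      rw [Function.update_self, if_pos rfl]
      omega
    · rw [Function.update_of_ne (Ne.symm h), if_neg h, add_zero]
  rw [List.countP_cons, hkl]
  congr 1
  · by_cases hlz : l = z
    · subst hlz
      rw [hz0, List.countP_eq_zero]
      intro p hp
      obtain ⟨q, -, rfl⟩ := List.mem_map.1 hp
      simp
    · obtain ⟨c, rfl⟩ := Fin.exists_succAbove_eq hlz
      rw [countP_map_succAbove, hcount, htilde]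
  · simp [num_injective.eq_iff]

end Step

/-! ### The base case: the star is the only tree of size zero. -/

section Base

theorem equiv_of_abShareVertex {A A' : TrivalentTree 0} (hA : A.ABShareVertex)
    (hA' : A'.ABShareVertex) : A ≈ A' := by
  have key : ∀ A : TrivalentTree 0, A.ABShareVertex →
      ∃ e : Option (Label 0) ≃ A.V, (∀ x, e (some x) = A.leaf x) ∧
        ∀ a b, A.G.Adj (e a) (e b) ↔ a.isSome ≠ b.isSome := by
    rintro A ⟨o, ha, -⟩
    have ho := A.ne_leaf_of_adj ha
    let f : Option (Label 0) → A.V := fun x => x.elim o A.leaf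
    have hf : Function.Bijective f := by
      constructor
      · rintro (_ | a) (_ | b) hab
        · rfl
        · exact absurd hab (ho b)
        · exact absurd hab.symm (ho a)
        · exact congrArg some (A.leaf_injective hab)
      · intro v
        rcases eq_or_eq_leaf ho v with rfl | ⟨x, rfl⟩
        · exact ⟨none, rfl⟩
        · exact ⟨some x, rfl⟩
    refine ⟨Equiv.ofBijective f hf, fun _ => rfl, ?_⟩
    rintro (_ | a) (_ | b)
    · simp
    · exact iff_of_true (adj_leaf_of_ne_leaf ho b) (by simp)
    · exact iff_of_true (adj_leaf_of_ne_leaf ho a).symm (by simp)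
    · exact iff_of_false (A.not_adj_leaf_leaf a b) (by simp)
  obtain ⟨e, he, hadj⟩ := key A hA
  obtain ⟨e', he', hadj'⟩ := key A' hA'
  refine ⟨⟨e.symm.trans e', fun {a b} => ?_⟩, fun x => ?_⟩
  · have h1 := hadj (e.symm a) (e.symm b)
    rw [e.apply_symm_apply, e.apply_symm_apply] at h1
    exact (hadj' _ _).trans h1.symm
  · change e' (e.symm _) = _
    rw [← he, e.symm_apply_apply, he']

theorem exists_abShareVertex : ∃ A : TrivalentTree 0, A.ABShareVertex := by
  -- The star arises by grafting two leaves onto one end of a single edge.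
  let G := graftGraph (⊤ : SimpleGraph Bool) true
  have hG : (⊤ : SimpleGraph Bool).IsTree :=
    ⟨SimpleGraph.connected_top, .of_card_le_two (by simp)⟩
  have h1 : (G.neighborSet (.inl true)).ncard = 3 := by
    rw [Set.ncard_eq_three]
    refine ⟨.inr true, .inr false, .inl false, by simp, by simp, by simp, Set.ext ?_⟩
    rintro ((_ | _) | (_ | _)) <;> simp [G, graftGraph]
  have h2 : (G.neighborSet (.inl false)).ncard = 1 := by
    rw [Set.ncard_eq_one]
    refine ⟨.inl true, Set.ext ?_⟩
    rintro ((_ | _) | (_ | _)) <;> simp [G, graftGraph]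
  have h3 : ∀ b, (G.neighborSet (.inr b)).ncard = 1 := by
    intro b
    rw [Set.ncard_eq_one]
    refine ⟨.inl true, Set.ext ?_⟩
    rintro ((_ | _) | (_ | _)) <;> simp [G, graftGraph]
  refine ⟨{
    V := Bool ⊕ Bool
    finite := inferInstance
    G := G
    isTree := graftGraph_isTree hG true
    degree := by
      rintro ((_ | _) | b)
      · exact Or.inl h2
      · exact Or.inr h1
      · exact Or.inl (h3 b)
    leaf := ![.inr true, .inr false, .inl false]
    leaf_injective := by decide
    leaf_range := by
      rintro ((_ | _) | (_ | _))
      · exact iff_of_true (by decide) h2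
      · exact iff_of_false (by decide) (by simp [h1])
      · exact iff_of_true (by decide) (h3 _)
      · exact iff_of_true (by decide) (h3 _) }, .inl true, rfl, rfl⟩

end Base

/-! ### Bijectivity of `τ`. -/

section Main

variable {n : ℕ}

/-- The filling gives `j` and the filling of the pruned tree, and `k` gives `i`; so both trees are
grafts of isomorphic trees at the same labels. -/
theorem tau_injOn {k : Fin n → ℕ} : Set.InjOn tau (Tour k) := by
  induction n with
  | zero =>
    intro T hT T' hT' _
    obtain ⟨A, rfl⟩ := T.exists_toClass_eq
    obtain ⟨A', rfl⟩ := T'.exists_toClass_eq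
    exact toClass_eq_iff.2 (equiv_of_abShareVertex hT.1 hT'.1)
  | succ n ih =>
    intro T hT T' hT' h
    obtain ⟨A, B, i, j, v, w, φ, rfl, hf, hp⟩ := Tour.exists_prunesTo hT
    obtain ⟨A', B', i', j', v', w', φ', rfl, hf', hp'⟩ := Tour.exists_prunesTo hT'
    obtain ⟨hB, h0, hr⟩ := hf.toClass_mem_tour hT hp
    obtain ⟨hB', h0', hr'⟩ := hf'.toClass_mem_tour hT' hp'
    obtain rfl : i = i' := (hf.isLastZero hT).unique (hf'.isLastZero hT')
    obtain rfl : j = j' := by rw [← h0, ← h0', h]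
    have := ih hB hB' (by rw [← hr, ← hr', h])
    exact toClass_eq_iff.2 (hp.equiv_of_equiv hp' (toClass_eq_iff.1 this))

theorem tau_mapsTo {k : Fin n → ℕ} : Set.MapsTo tau (Tour k) (CPF k) := by
  induction n with
  | zero =>
    intro T _
    exact ⟨fun c => c.elim0, fun c => c.elim0, fun c => c.elim0⟩
  | succ n ih =>
    intro T hT
    obtain ⟨A, B, i, j, v, w, φ, rfl, hf, hp⟩ := Tour.exists_prunesTo hT
    obtain ⟨hB, h0, hr⟩ := hf.toClass_mem_tour hT hp
    obtain ⟨hAB, rs, hrs, hk⟩ := toClass_mem_tour_iff.1 hT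
    rw [Filling.mem_CPF_iff _ fun c => (height_tau hAB hrs c).trans (hk c), h0, hr]
    exact ⟨(hf.isLastZero hT).aboveZeros hf.lt, ih hB⟩

theorem tau_surjOn {k : Fin n → ℕ} : Set.SurjOn tau (Tour k) (CPF k) := by
  induction n with
  | zero =>
    intro P _
    obtain ⟨A, hA⟩ := exists_abShareVertex
    refine ⟨A.toClass, ⟨hA, [], (isTournament_zero_iff hA).2 rfl, fun j => j.elim0⟩, ?_⟩
    funext m
    exact m.elim0
  | succ n ih =>
    intro P hP
    obtain ⟨h0, hr⟩ := (P.mem_CPF_iff hP.2.2).1 hP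
    obtain ⟨T', hT', hτ⟩ := ih hr
    obtain ⟨B, rfl⟩ := T'.exists_toClass_eq
    obtain ⟨T, hT, hT0, hTs⟩ := exists_tour_of_mem_tour_tilde hP.2.2 h0 hT'
    refine ⟨T, hT, funext fun m => ?_⟩
    induction m using Fin.cases with
    | zero => exact hT0
    | succ m => rw [hTs, hτ, P.succAbove_r]

end Main

/-- The first part says that `τ` is a bijection from `Tour(k)` to `CPF(k)`. The second part is the
commutative square: `P ↦ (P 0, r P)`, where `P 0` is the column of car `1`, is the map `r̂` from
`CPF(k)` to the disjoint union of the `CPF(k̃_j)`, `j > i`; the relation `IsPiLazy k` is the graph of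
a map `T ↦ (j, T')` from `Tour(k)` to the disjoint union of the `Tour(k̃_j)`, `j > i`; and `τ`
intertwines the two maps. -/
theorem proposition4 :
    (∀ (n : ℕ) (k : Fin n → ℕ), ∑ l, k l = n →
      (∀ T ∈ Tour k, ∀ m j : Fin n, tau T m = j ↔ T.WinsRound j m) ∧
      Set.BijOn tau (Tour k) (CPF k)) ∧
    (∀ (n : ℕ) (k : Fin (n + 1) → ℕ), ∑ l, k l = n + 1 →
      (∀ P ∈ CPF k, AboveZeros k (P 0) ∧ P.r ∈ CPF (tilde k (P 0))) ∧
      (∀ T ∈ Tour k, ∃ (j : Fin (n + 1)) (T' : TreeClass n),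
        (∀ j' T'', T.IsPiLazy k j' T'' ↔ j' = j ∧ T'' = T') ∧
        AboveZeros k j ∧ T' ∈ Tour (tilde k j) ∧
        (tau T 0, (tau T).r) = (j, tau T'))) := by
  refine ⟨fun n k _ => ⟨fun T hT m j => ?_, tau_mapsTo, tau_injOn, tau_surjOn⟩,
    fun n k _ => ⟨fun P hP => (P.mem_CPF_iff hP.2.2).1 hP, fun T hT => ?_⟩⟩
  · obtain ⟨A, rfl⟩ := T.exists_toClass_eq
    exact tau_eq_iff hT.1 m j
  · obtain ⟨A, B, i, j, v, w, φ, rfl, hf, hp⟩ := Tour.exists_prunesTo hT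
    obtain ⟨hB, h0, hr⟩ := hf.toClass_mem_tour hT hp
    exact ⟨j, B.toClass, hf.isPiLazy_toClass_iff hp, (hf.isLastZero hT).aboveZeros hf.lt, hB,
      by rw [h0, hr]⟩
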